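/- Let $m,c>0$. For ${\bf q}\in\mathbb{R}^3$ put $q^0=c\sqrt{(mc)^2+|{\bf q}|^2}$, $q^\mu=(q^0,c\,{\bf q})$ ($\mu=0,\dots,3$), and use the metric $\mathrm{diag}(1,-1,-1,-1)$ to lower indices, with summation over repeated indices. For $f:\mathbb{R}^3\to\mathbb{R}$ put $$N^\mu=\int_{\mathbb{R}^3} q^\mu f\,\frac{d{\bf q}}{q^0},\qquad T^{\mu\nu}=\frac1m\int_{\mathbb{R}^3} q^\mu q^\nu f\,\frac{d{\bf q}}{q^0},\qquad n_f=\sqrt{N^\mu N_\mu},\qquad n_f{\bf u}_f=(N^1,N^2,N^3).$$ For $n\ge0$, $\beta>0$, ${\bf u}\in\mathbb{R}^3$ and $u^\mu=(\sqrt{1+|{\bf u}|^2},{\bf u})$, the Jüttner distribution is $$J(n,\beta,{\bf u};{\bf q})=\frac{n}{(mc)^3M(\beta)}\exp\Big\{-\frac{\beta}{mc^2}u_\mu q^\mu\Big\},\qquad M(\beta)=\int_{\mathbb{R}^3}e^{-\beta\sqrt{1+|{\bf p}|^2}}\,d{\bf p},$$ and $K_j(\beta)=\int_0^\infty\cosh(jr)\,e^{-\beta\cosh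 r}\,dr$ are the modified Bessel functions. (1) Let $f\ge0$ almost everywhere, not almost everywhere zero, be such that all the integrals defining $N^\mu$ and $T^{\mu\nu}$ converge absolutely. Then there is exactly one triple $(n,\beta,{\bf u})$ with $n\ge0$, $\beta>0$, ${\bf u}\in\mathbb{R}^3$ such that $J_f=J(n,\beta,{\bf u};\cdot)$ satisfies $$\int_{\mathbb{R}^3} J_f\,\frac{d{\bf q}}{q^0}=\int_{\mathbb{R}^3} f\,\frac{d{\bf q}}{q^0},\qquad \int_{\mathbb{R}^3} q^\mu J_f\,\frac{d{\bf q}}{q^0}=\int_{\mathbb{R}^3} q^\mu f\,\frac{d{\bf q}}{q^0}\quad(\mu=0,\dots,3).$$ Moreover $n_f>0$, and the triple is $n=n_f$, ${\bf u}={\bf u}_f$, $\beta=\beta_f$, where $\beta_f$ is the unique solution $\beta>0$ of $$\frac{K_1(\beta)}{K_2(\beta)}=\frac{mc^2}{n_f}\int_{\mathbb{R}^3} f\,\frac{d{\bf q}}{q^0}.$$ (2) Let $\omega\in\mathbb{R}$, let $U\subseteq\mathbb{R}_t\times\mathbb{R}^3_x$ be open, and consider on $U\times\mathbb{R}^3$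 the relativistic BGK equation $$\partial_tf+c\,\hat q\cdot\nabla_xf=\frac{mc^2\omega}{q^0}(J_f-f),\qquad \hat q=\frac{{\bf q}}{\sqrt{(mc)^2+|{\bf q}|^2}},$$ where $J_f(t,x,\cdot)=J(n_f,\beta_f,{\bf u}_f;\cdot)$ is built from $f(t,x,\cdot)$ as in (1) (and $J_f=0$ where $f(t,x,\cdot)=0$ almost everywhere). Write the conservation laws, with $x^0=ct$, as $$\frac{\partial N^\mu}{\partial x^\mu}=0,\qquad \frac{\partial T^{\mu\nu}}{\partial x^\nu}=0\quad(\mu=0,\dots,3).$$ (a) If $f\ge0$ almost everywhere, the integrands $q^\mu f/q^0$ and $q^\mu q^\nu f/q^0$ are integrable over $K\times\mathbb{R}^3$ for each compact $K\subset U$, and $f$ solves the equation in the sense of distributions on $U\times\mathbb{R}^3$, then $N^\mu,T^{\mu\nu}\in L^1_{\rm loc}(U)$ and the conservation laws hold in the sense of distributions on $U$. (b) If $f\ge0$ is measurable, $f(\cdot,\cdot,{\bf q})\in C^1(U)$ for each ${\bf q}$, the integrals defining $N^\mu,T^{\mu\nu}$ converge absolutely at each $(t,x)\in U$ and define $C^1$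 functions on $U$, and $f$ solves the equation at each point of $U\times\mathbb{R}^3$, then the conservation laws hold at each point of $U$. -/

import Mathlib

open MeasureTheory Set Filter

namespace RelBGK

noncomputable section

/-- Euclidean three-space, for positions and for momenta. -/
abbrev E3 : Type := EuclideanSpace ℝ (Fin 3)

/-- Space-time points `(t, x)`; the zeroth Minkowski coordinate is `c * t`. -/
abbrev Spacetime : Type := ℝ × E3

/-! ### Minkowski space -/

/-- The metric `diag (1, -1, -1, -1)`. -/
def metric (μ ν : Fin 4) : ℝ := if μ = ν then (if μ = 0 then 1 else -1) else 0

/-- Lowering of an index, `v_μ = g_{μν} v^ν`. -/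
def lower (v : Fin 4 → ℝ) (μ : Fin 4) : ℝ := ∑ ν, metric μ ν * v ν

/-- The contraction `v_μ w^μ`. -/
def contract (v w : Fin 4 → ℝ) : ℝ := ∑ μ, lower v μ * w μ

/-- `q^0 = c √((mc)² + |q|²)`. -/
def energy (m c : ℝ) (q : E3) : ℝ := c * √((m * c) ^ 2 + ‖q‖ ^ 2)

/-- The energy-momentum four-vector `q^μ = (q^0, c q)`. -/
def fourMomentum (m c : ℝ) (q : E3) : Fin 4 → ℝ :=
  Fin.cons (energy m c q) (fun i : Fin 3 => c * q i)

/-- The four-velocity `u^μ = (√(1 + |u|²), u)` with spatial part `u`. -/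
def fourVelocity (u : E3) : Fin 4 → ℝ :=
  Fin.cons (√(1 + ‖u‖ ^ 2)) (fun i : Fin 3 => u i)

/-! ### Macroscopic quantities of a momentum distribution -/

/-- `∫ f dq / q^0`. -/
def scalarMoment (m c : ℝ) (f : E3 → ℝ) : ℝ := ∫ q, f q / energy m c q

/-- `N^μ = ∫ q^μ f dq / q^0`. -/
def particleFlux (m c : ℝ) (f : E3 → ℝ) (μ : Fin 4) : ℝ :=
  ∫ q, fourMomentum m c q μ * f q / energy m c q

/-- `T^{μν} = (1/m) ∫ q^μ q^ν f dq / q^0`. -/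
def energyMomentum (m c : ℝ) (f : E3 → ℝ) (μ ν : Fin 4) : ℝ :=
  1 / m * ∫ q, fourMomentum m c q μ * fourMomentum m c q ν * f q / energy m c q

/-- The moments `N^μ` and `T^{μν}` exist: their integrands are integrable. -/
def HasMoments (m c : ℝ) (f : E3 → ℝ) : Prop :=
  (∀ μ, Integrable (fun q => fourMomentum m c q μ * f q / energy m c q)) ∧
  (∀ μ ν, Integrable
    (fun q => fourMomentum m c q μ * fourMomentum m c q ν * f q / energy m c q))

/-- The proper particle density `n_f = √(N^μ N_μ)`. -/
def properDensity (m c : ℝ) (f : E3 → ℝ) : ℝ :=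
  √(contract (particleFlux m c f) (particleFlux m c f))

/-- The spatial part `u_f` of the four-velocity, `n_f u_f^i = N^i`. -/
def velocity (m c : ℝ) (f : E3 → ℝ) : E3 :=
  WithLp.toLp 2 (fun i : Fin 3 => particleFlux m c f i.succ / properDensity m c f)

/-! ### Jüttner distributions -/

/-- `M(β) = ∫ exp (-β √(1 + |p|²)) dp`. -/
def juttnerMass (β : ℝ) : ℝ := ∫ p : E3, Real.exp (-β * √(1 + ‖p‖ ^ 2))

/-- `J(n, β, u; q) = n / ((mc)³ M(β)) * exp (-(β / (m c²)) u_μ q^μ)`. -/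
def juttner (m c n β : ℝ) (u q : E3) : ℝ :=
  n / ((m * c) ^ 3 * juttnerMass β) *
    Real.exp (-(β / (m * c ^ 2)) * contract (fourVelocity u) (fourMomentum m c q))

/-- The modified Bessel function `K_j(β) = ∫_0^∞ cosh (j r) exp (-β cosh r) dr`. -/
def besselK (j : ℕ) (β : ℝ) : ℝ :=
  ∫ r in Ioi (0 : ℝ), Real.cosh (j * r) * Real.exp (-β * Real.cosh r)

/-- The equation `K_1(β) / K_2(β) = (m c² / n_f) ∫ f dq / q^0` for `β > 0`. -/
def SolvesBetaEq (m c : ℝ) (f : E3 → ℝ) (β : ℝ) : Prop :=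
  0 < β ∧ besselK 1 β / besselK 2 β = m * c ^ 2 / properDensity m c f * scalarMoment m c f

/-- `β_f`: the solution of the equation for `β` (an arbitrary number if there is none). -/
def beta (m c : ℝ) (f : E3 → ℝ) : ℝ := Classical.epsilon (SolvesBetaEq m c f)

/-- `J_f = J(n_f, β_f, u_f; ·)`. In vacuum, `f = 0` almost everywhere, one has `n_f = 0`, hence
`J_f = 0` whatever the values of `β_f` and `u_f`. -/
def localJuttner (m c : ℝ) (f : E3 → ℝ) : E3 → ℝ :=
  juttner m c (properDensity m c f) (beta m c f) (velocity m c f)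

/-- The function `g` satisfies `∫ g dq / q^0 = ∫ f dq / q^0` and
`∫ q^μ g dq / q^0 = ∫ q^μ f dq / q^0`, the integrals of `g` being convergent. -/
def SameMoments (m c : ℝ) (f g : E3 → ℝ) : Prop :=
  Integrable (fun q => g q / energy m c q) ∧
  (∀ μ, Integrable (fun q => fourMomentum m c q μ * g q / energy m c q)) ∧
  scalarMoment m c g = scalarMoment m c f ∧
  ∀ μ, particleFlux m c g μ = particleFlux m c f μ

/-! ### The relativistic BGK equation and the conservation laws -/

/-- `∂_t`. -/
def partialT (φ : Spacetime → ℝ) (X : Spacetime) : ℝ := fderiv ℝ φ X (1, 0)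

/-- `∂ / ∂x_i`. -/
def partialX (i : Fin 3) (φ : Spacetime → ℝ) (X : Spacetime) : ℝ :=
  fderiv ℝ φ X (0, EuclideanSpace.single i 1)

/-- `∂ / ∂x^μ`, where `x^0 = c t`. -/
def partialST (c : ℝ) (μ : Fin 4) (φ : Spacetime → ℝ) (X : Spacetime) : ℝ :=
  (Fin.cons (1 / c * partialT φ X) (fun i : Fin 3 => partialX i φ X) : Fin 4 → ℝ) μ

/-- The transport operator `∂_t + c q̂ · ∇_x`, with `q̂ = q / √((mc)² + |q|²)`. -/
def transport (m c : ℝ) (q : E3) (φ : Spacetime → ℝ) (X : Spacetime) : ℝ :=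
  partialT φ X + c * ∑ i : Fin 3, q i / √((m * c) ^ 2 + ‖q‖ ^ 2) * partialX i φ X

/-- The right-hand side `(m c² ω / q^0) (J_f - f)`. -/
def relaxation (m c ω : ℝ) (f : E3 → ℝ) (q : E3) : ℝ :=
  m * c ^ 2 * ω / energy m c q * (localJuttner m c f q - f q)

/-- `f` solves the relativistic BGK equation on `U × ℝ³` in the sense of distributions. -/
def IsWeakSolution (m c ω : ℝ) (U : Set Spacetime) (f : Spacetime → E3 → ℝ) : Prop :=
  ∀ φ : Spacetime × E3 → ℝ, ContDiff ℝ ((⊤ : ℕ∞) : WithTop ℕ∞) φ → HasCompactSupport φ →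
    tsupport φ ⊆ U ×ˢ (univ : Set E3) →
    ∫ z : Spacetime × E3, (f z.1 z.2 * transport m c z.2 (fun X => φ (X, z.2)) z.1 +
      relaxation m c ω (f z.1) z.2 * φ z) = 0

/-- A phase density over `U` whose moments `N^μ`, `T^{μν}` exist as locally integrable
functions of `(t, x)`: it is nonnegative almost everywhere, and the integrands of the moments are
integrable over `K × ℝ³` for each compact `K ⊆ U`. -/
structure IsWeakPhaseDensity (m c : ℝ) (U : Set Spacetime) (f : Spacetime → E3 → ℝ) : Prop where
  nonneg : ∀ᵐ z : Spacetime × E3 ∂(volume.restrict (U ×ˢ (univ : Set E3))), 0 ≤ f z.1 z.2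
  integrable_flux : ∀ K : Set Spacetime, IsCompact K → K ⊆ U → ∀ μ,
    IntegrableOn (fun z : Spacetime × E3 =>
      fourMomentum m c z.2 μ * f z.1 z.2 / energy m c z.2) (K ×ˢ (univ : Set E3))
  integrable_tensor : ∀ K : Set Spacetime, IsCompact K → K ⊆ U → ∀ μ ν,
    IntegrableOn (fun z : Spacetime × E3 =>
      fourMomentum m c z.2 μ * fourMomentum m c z.2 ν * f z.1 z.2 / energy m c z.2)
      (K ×ˢ (univ : Set E3))

/-- A vector field `V^μ` on `U` is locally integrable and satisfies `∂V^μ / ∂x^μ = 0` in the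
sense of distributions. -/
def WeakDivFree (c : ℝ) (U : Set Spacetime) (V : Spacetime → Fin 4 → ℝ) : Prop :=
  (∀ μ, LocallyIntegrableOn (fun X => V X μ) U) ∧
  ∀ φ : Spacetime → ℝ, ContDiff ℝ ((⊤ : ℕ∞) : WithTop ℕ∞) φ → HasCompactSupport φ → tsupport φ ⊆ U →
    ∫ X, ∑ μ, V X μ * partialST c μ φ X = 0

/-- A phase density over `U` whose moments exist at each point of `U` and are continuously
differentiable there, and which solves the relativistic BGK equation pointwise. -/
structure IsClassicalSolution (m c ω : ℝ) (U : Set Spacetime) (f : Spacetime → E3 → ℝ) :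
    Prop where
  measurable : AEStronglyMeasurable (fun z : Spacetime × E3 => f z.1 z.2)
    (volume.restrict (U ×ˢ (univ : Set E3)))
  nonneg : ∀ X ∈ U, ∀ q, 0 ≤ f X q
  hasMoments : ∀ X ∈ U, HasMoments m c (f X)
  contDiff : ∀ q, ContDiffOn ℝ 1 (fun X => f X q) U
  contDiff_flux : ∀ μ, ContDiffOn ℝ 1 (fun X => particleFlux m c (f X) μ) U
  contDiff_tensor : ∀ μ ν, ContDiffOn ℝ 1 (fun X => energyMomentum m c (f X) μ ν) U
  equation : ∀ X ∈ U, ∀ q, transport m c q (fun Y => f Y q) X = relaxation m c ω (f X) q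

/-- A vector field satisfies `∂V^μ / ∂x^μ = 0` at each point of `U`. -/
def DivFree (c : ℝ) (U : Set Spacetime) (V : Spacetime → Fin 4 → ℝ) : Prop :=
  ∀ X ∈ U, ∑ μ, partialST c μ (fun Y => V Y μ) X = 0

end

end RelBGK

open RelBGK

namespace RelBGK

open scoped Topology

/-! ### Modified Bessel functions -/

/-! Equilibrium. A Jüttner distribution is an isotropic one seen from a moving frame, and `dp / √(1
+ |p|²)` is invariant under boosts (`integral_comp_boost`). Its moments can therefore be computed at
rest: `N^μ = n u^μ` (`particleFlux_juttner`) and `∫ J dq / q^0 = n / (m c²) · K₁(β) / K₂(β)`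
(`scalarMoment_juttner`). As `u_μ u^μ = 1`, matching `N^μ` forces `n = n_f` and `u = u_f`, and one
scalar equation for `β` remains. It has exactly one solution for three reasons: `N` is strictly
timelike because `c |q| < q^0` (`norm_fluxVector_lt`); the right-hand side lies in `(0, 1)` because
`u_μ q^μ > m c²` off a single point (`scalarMoment_lt`); and `K₁ / K₂` increases strictly on `(0,
∞)` and attains every value in `(0, 1)` (`besselRatio_strictMonoOn`, `exists_besselRatio_eq`).

Conservation laws. Transport is `c (q^μ / q^0) ∂_μ`, and the collision term, weighted by `1` or
`q^ν`, has zero momentum integral by the matching of moments. In the distributional setting these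
weights are not compactly supported in `q`, so they are reached by cutoffs and dominated convergence
(`IsWeakSolution.integral_eq_zero_of_weight`). This needs `J_f` to be jointly measurable, which
holds since `β_f` is a measurable function of the moments (`measurable_besselRatioInv`), and
integrable, which holds since `J_f ≥ 0` has the same `N^0` as `f`.

A classical solution is not differentiated under the momentum integral, as nothing dominates its
derivatives. Instead it is shown to be a distributional solution
(`IsClassicalSolution.isWeakSolution`), and a `C¹` field whose divergence vanishes weakly has zero
divergence pointwise (`WeakDivFree.divFree`). -/

theorem exists_exp_mul_exp_neg_cosh_le {b : ℝ} (hb : 0 < b) (k : ℕ) :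
    ∃ C : ℝ, 0 ≤ C ∧ ∀ β, b ≤ β → ∀ r : ℝ,
      Real.exp (k * r) * Real.exp (-β * Real.cosh r) ≤ C * Real.exp (-r) := by
  -- The constant comes from `x ^ (k + 1) / (k + 1)! ≤ exp x` at `x = (b / 2) exp r`; the extra
  -- power leaves the factor `exp (-r)`. It depends on `b` but not on `β`, which gives the locally
  -- uniform domination behind `continuousOn_besselK`.
  refine ⟨(k + 1).factorial / (b / 2) ^ (k + 1), by positivity, fun β hβ r => ?_⟩
  have h0 : b / 2 * Real.exp r ≤ β * Real.cosh r := by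
    have h1 : Real.exp r / 2 ≤ Real.cosh r := by
      rw [Real.cosh_eq]; linarith [Real.exp_pos (-r)]
    calc b / 2 * Real.exp r = b * (Real.exp r / 2) := by ring
      _ ≤ b * Real.cosh r := by gcongr
      _ ≤ β * Real.cosh r := by gcongr
  have h1 : (b / 2 * Real.exp r) ^ (k + 1) / (k + 1).factorial ≤ Real.exp (β * Real.cosh r) :=
    (Real.pow_div_factorial_le_exp (b / 2 * Real.exp r) (by positivity) (k + 1)).trans
      (Real.exp_le_exp.2 h0)
  have h2 : (b / 2 * Real.exp r) ^ (k + 1)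
      = (b / 2) ^ (k + 1) * (Real.exp (k * r) * Real.exp r) := by
    rw [mul_pow, ← Real.exp_nat_mul, ← Real.exp_add]; congr 2; push_cast; ring
  rw [h2, div_le_iff₀ (by positivity)] at h1
  rw [neg_mul, Real.exp_neg, Real.exp_neg, ← div_eq_mul_inv, div_le_iff₀ (Real.exp_pos _)]
  have h3 : (0 : ℝ) < (b / 2) ^ (k + 1) := by positivity
  rw [show ((k + 1).factorial : ℝ) / (b / 2) ^ (k + 1) * (Real.exp r)⁻¹ * Real.exp (β * Real.cosh r)
    = (Real.exp (β * Real.cosh r) * (k + 1).factorial) / ((b / 2) ^ (k + 1) * Real.exp r) by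
      field_simp, le_div_iff₀ (by positivity)]
  linarith

theorem abs_le_exp_integrableOn {β : ℝ} (hβ : 0 < β) (k : ℕ) {g : ℝ → ℝ} (hg : Continuous g)
    (h : ∀ r, 0 ≤ r → |g r| ≤ Real.exp (k * r)) :
    IntegrableOn (fun r => g r * Real.exp (-β * Real.cosh r)) (Ioi 0) := by
  obtain ⟨C, hC, hle⟩ := exists_exp_mul_exp_neg_cosh_le hβ k
  refine Integrable.mono' ((integrableOn_exp_neg_Ioi 0).const_mul C)
    (Continuous.aestronglyMeasurable (by fun_prop)) ?_
  refine (ae_restrict_iff' measurableSet_Ioi).2 (Eventually.of_forall fun r hr => ?_)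
  rw [Real.norm_eq_abs, abs_mul, Real.abs_exp]
  exact (mul_le_mul_of_nonneg_right (h r (le_of_lt hr)) (Real.exp_pos _).le).trans (hle β le_rfl r)

theorem tendsto_mul_exp_neg_cosh {β : ℝ} (hβ : 0 < β) (k : ℕ) {g : ℝ → ℝ}
    (h : ∀ r, 0 ≤ r → |g r| ≤ Real.exp (k * r)) :
    Tendsto (fun r => g r * Real.exp (-β * Real.cosh r)) atTop (𝓝 0) := by
  obtain ⟨C, hC, hle⟩ := exists_exp_mul_exp_neg_cosh_le hβ k
  have h0 : Tendsto (fun r : ℝ => C * Real.exp (-r)) atTop (𝓝 0) := by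
    simpa using Real.tendsto_exp_neg_atTop_nhds_zero.const_mul C
  refine squeeze_zero_norm' ?_ h0
  filter_upwards [eventually_ge_atTop 0] with r hr
  rw [Real.norm_eq_abs, abs_mul, Real.abs_exp]
  exact (mul_le_mul_of_nonneg_right (h r hr) (Real.exp_pos _).le).trans (hle β le_rfl r)

theorem cosh_le_exp {r : ℝ} (hr : 0 ≤ r) : Real.cosh r ≤ Real.exp r := by
  rw [Real.cosh_eq]
  linarith [Real.exp_le_exp.2 (show -r ≤ r by linarith)]

theorem abs_sinh_le_exp {r : ℝ} (hr : 0 ≤ r) : |Real.sinh r| ≤ Real.exp r := by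
  rw [abs_of_nonneg (Real.sinh_nonneg_iff.2 hr)]
  exact (Real.sinh_lt_cosh r).le.trans (cosh_le_exp hr)

theorem abs_cosh_le_exp {r : ℝ} (hr : 0 ≤ r) : |Real.cosh r| ≤ Real.exp r := by
  rw [abs_of_pos (Real.cosh_pos r)]; exact cosh_le_exp hr

theorem abs_cosh_nat_mul_le_exp (j : ℕ) {r : ℝ} (hr : 0 ≤ r) :
    |Real.cosh (j * r)| ≤ Real.exp (j * r) :=
  abs_cosh_le_exp (by positivity)

theorem integrableOn_besselK (j : ℕ) {β : ℝ} (hβ : 0 < β) :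
    IntegrableOn (fun r => Real.cosh (j * r) * Real.exp (-β * Real.cosh r)) (Ioi 0) :=
  abs_le_exp_integrableOn hβ j (by fun_prop) fun _ hr => abs_cosh_nat_mul_le_exp j hr

theorem exp_nat_two (r : ℝ) : Real.exp ((2 : ℕ) * r) = Real.exp r * Real.exp r := by
  rw [← Real.exp_add]; congr 1; push_cast; ring

theorem exp_nat_three (r : ℝ) :
    Real.exp ((3 : ℕ) * r) = Real.exp r * Real.exp r * Real.exp r := by
  rw [← Real.exp_add, ← Real.exp_add]; congr 1; push_cast; ring

theorem integrableOn_sinh_sq {β : ℝ} (hβ : 0 < β) :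
    IntegrableOn (fun r => Real.sinh r ^ 2 * Real.exp (-β * Real.cosh r)) (Ioi 0) :=
  abs_le_exp_integrableOn hβ 2 (by fun_prop) fun r hr => by
    rw [exp_nat_two, sq, abs_mul]
    gcongr <;> exact abs_sinh_le_exp hr

theorem integrableOn_sinh_sq_cosh {β : ℝ} (hβ : 0 < β) :
    IntegrableOn (fun r => Real.sinh r ^ 2 * Real.cosh r * Real.exp (-β * Real.cosh r))
      (Ioi 0) :=
  abs_le_exp_integrableOn hβ 3 (by fun_prop) fun r hr => by
    rw [exp_nat_three, sq, abs_mul, abs_mul]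
    gcongr
    exacts [abs_sinh_le_exp hr, abs_sinh_le_exp hr, abs_cosh_le_exp hr]

/-- The total derivative of `sinh r * exp (-β cosh r)` integrates to zero, as both boundary values
vanish. -/
theorem integral_sinh_sq {β : ℝ} (hβ : 0 < β) :
    ∫ r in Ioi (0 : ℝ), Real.sinh r ^ 2 * Real.exp (-β * Real.cosh r) = besselK 1 β / β := by
  have hd : ∀ r ∈ Ici (0 : ℝ), HasDerivAt (fun r => Real.sinh r * Real.exp (-β * Real.cosh r))
      (Real.cosh ((1 : ℕ) * r) * Real.exp (-β * Real.cosh r)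
        - β * (Real.sinh r ^ 2 * Real.exp (-β * Real.cosh r))) r := fun r _ => by
    refine ((Real.hasDerivAt_sinh r).mul
      (((Real.hasDerivAt_cosh r).const_mul (-β)).exp)).congr_deriv ?_
    rw [Nat.cast_one, one_mul]; ring
  have := integral_Ioi_of_hasDerivAt_of_tendsto' hd
    ((integrableOn_besselK 1 hβ).sub ((integrableOn_sinh_sq hβ).const_mul β))
    (tendsto_mul_exp_neg_cosh hβ 1 fun r hr => by simpa using abs_sinh_le_exp hr)
  rw [integral_sub (integrableOn_besselK 1 hβ) ((integrableOn_sinh_sq hβ).const_mul β),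
    integral_const_mul] at this
  simp only [Real.sinh_zero, zero_mul, sub_zero] at this
  rw [eq_div_iff hβ.ne', besselK]
  linarith

/-- Integration by parts again, now with `sinh r * cosh r`, whose derivative is `cosh (2 r)`. -/
theorem integral_sinh_sq_cosh {β : ℝ} (hβ : 0 < β) :
    ∫ r in Ioi (0 : ℝ), Real.sinh r ^ 2 * Real.cosh r * Real.exp (-β * Real.cosh r)
      = besselK 2 β / β := by
  have hd : ∀ r ∈ Ici (0 : ℝ),
      HasDerivAt (fun r => Real.sinh r * Real.cosh r * Real.exp (-β * Real.cosh r))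
      (Real.cosh ((2 : ℕ) * r) * Real.exp (-β * Real.cosh r)
        - β * (Real.sinh r ^ 2 * Real.cosh r * Real.exp (-β * Real.cosh r))) r := fun r _ => by
    refine (((Real.hasDerivAt_sinh r).mul (Real.hasDerivAt_cosh r)).mul
      (((Real.hasDerivAt_cosh r).const_mul (-β)).exp)).congr_deriv ?_
    simp only [Nat.cast_ofNat, Real.cosh_two_mul, Pi.mul_apply]; ring
  have := integral_Ioi_of_hasDerivAt_of_tendsto' hd
    ((integrableOn_besselK 2 hβ).sub ((integrableOn_sinh_sq_cosh hβ).const_mul β))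
    (tendsto_mul_exp_neg_cosh hβ 2 fun r hr => by
      rw [exp_nat_two, abs_mul]
      gcongr
      exacts [abs_sinh_le_exp hr, abs_cosh_le_exp hr])
  rw [integral_sub (integrableOn_besselK 2 hβ) ((integrableOn_sinh_sq_cosh hβ).const_mul β),
    integral_const_mul] at this
  simp only [Real.sinh_zero, zero_mul, sub_zero] at this
  rw [eq_div_iff hβ.ne', besselK]
  linarith

theorem setIntegral_Ioi_pos {g : ℝ → ℝ} (hg : IntegrableOn g (Ioi 0))
    (h : ∀ r, 0 < r → 0 < g r) : 0 < ∫ r in Ioi (0 : ℝ), g r := by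
  rw [setIntegral_pos_iff_support_of_nonneg_ae
    ((ae_restrict_iff' measurableSet_Ioi).2 (Eventually.of_forall fun r hr => (h r hr).le)) hg]
  have : Function.support g ∩ Ioi 0 = Ioi 0 :=
    inter_eq_right.2 fun r hr => (h r hr).ne'
  rw [this]; simp

theorem besselK_pos (j : ℕ) {β : ℝ} (hβ : 0 < β) : 0 < besselK j β :=
  setIntegral_Ioi_pos (integrableOn_besselK j hβ) fun _ _ =>
    mul_pos (Real.cosh_pos _) (Real.exp_pos _)

/-- This is `cosh (2 r) = 1 + 2 sinh² r` under the integral sign. -/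
theorem besselK_two_eq {β : ℝ} (hβ : 0 < β) :
    besselK 2 β = besselK 0 β + 2 * (besselK 1 β / β) := by
  rw [← integral_sinh_sq hβ, besselK, besselK, ← integral_const_mul,
    ← integral_add (integrableOn_besselK 0 hβ) ((integrableOn_sinh_sq hβ).const_mul 2)]
  congr 1; ext r
  simp only [Nat.cast_zero, zero_mul, Real.cosh_zero, Nat.cast_ofNat, Real.cosh_two_mul,
    Real.cosh_sq]
  ring

theorem besselK_zero_le_one {β : ℝ} (hβ : 0 < β) : besselK 0 β ≤ besselK 1 β := by
  refine setIntegral_mono (integrableOn_besselK 0 hβ) (integrableOn_besselK 1 hβ) fun r => ?_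
  simpa using mul_le_mul_of_nonneg_right (Real.one_le_cosh r) (Real.exp_pos _).le

/-- The ratio `K₁ / K₂`. -/
noncomputable def besselRatio (β : ℝ) : ℝ := besselK 1 β / besselK 2 β

/-! ### Range and strict monotonicity of `K₁ / K₂`. -/

theorem besselRatio_pos {β : ℝ} (hβ : 0 < β) : 0 < besselRatio β :=
  div_pos (besselK_pos 1 hβ) (besselK_pos 2 hβ)

theorem besselRatio_le_self {β : ℝ} (hβ : 0 < β) : besselRatio β ≤ β := by
  have h0 := besselK_pos 0 hβ
  have h1 := besselK_pos 1 hβ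
  rw [besselRatio, div_le_iff₀ (besselK_pos 2 hβ), besselK_two_eq hβ]
  have : β * (2 * (besselK 1 β / β)) = 2 * besselK 1 β := by field_simp
  nlinarith

/-- The recurrence with `K₀ ≤ K₁` gives `K₂ ≤ K₁ (1 + 2 / β)`, and `(1 - 2 / β) (1 + 2 / β) ≤ 1`.
Together with `besselRatio_le_self` it brackets every value in `(0, 1)`. -/
theorem le_besselRatio {β : ℝ} (hβ : 0 < β) : 1 - 2 / β ≤ besselRatio β := by
  have h1 := besselK_pos 1 hβ
  have h2 : besselK 2 β ≤ besselK 1 β * (1 + 2 / β) := by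
    rw [besselK_two_eq hβ]
    have : besselK 1 β * (1 + 2 / β) = besselK 1 β + 2 * (besselK 1 β / β) := by ring
    linarith [besselK_zero_le_one hβ]
  rw [besselRatio, le_div_iff₀ (besselK_pos 2 hβ)]
  by_cases h : 1 - 2 / β ≤ 0
  · nlinarith [besselK_pos 2 hβ]
  · push Not at h
    calc (1 - 2 / β) * besselK 2 β ≤ (1 - 2 / β) * (besselK 1 β * (1 + 2 / β)) := by gcongr
      _ = besselK 1 β * (1 - (2 / β) ^ 2) := by ring
      _ ≤ besselK 1 β := by nlinarith [sq_nonneg (2 / β)]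

theorem continuousOn_besselK (j : ℕ) : ContinuousOn (besselK j) (Ioi 0) := by
  intro β hβ
  have hb : 0 < β / 2 := half_pos hβ
  obtain ⟨C, hC, hle⟩ := exists_exp_mul_exp_neg_cosh_le hb j
  refine (continuousAt_of_dominated (bound := fun r => C * Real.exp (-r)) ?_ ?_ ?_ ?_).continuousWithinAt
  · exact Eventually.of_forall fun b => Continuous.aestronglyMeasurable (by fun_prop)
  · filter_upwards [Ioi_mem_nhds (half_lt_self (show (0:ℝ) < β from hβ))] with b hb'
    refine (ae_restrict_iff' measurableSet_Ioi).2 (Eventually.of_forall fun r hr => ?_)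
    rw [Real.norm_eq_abs, abs_mul, Real.abs_exp]
    exact (mul_le_mul_of_nonneg_right (abs_cosh_nat_mul_le_exp j (le_of_lt hr))
      (Real.exp_pos _).le).trans (hle b (le_of_lt hb') r)
  · exact (integrableOn_exp_neg_Ioi 0).const_mul C
  · exact Eventually.of_forall fun r => Continuous.continuousAt (by fun_prop)

theorem continuousOn_besselRatio : ContinuousOn besselRatio (Ioi 0) :=
  (continuousOn_besselK 1).div (continuousOn_besselK 2) fun _ hβ => (besselK_pos 2 hβ).ne'

/-- A Chebyshev-type argument. With `a` the ratio at `b`, the integral of `(1 - a cosh r) sinh² r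
exp (-b cosh r)` is zero. Passing from `b` to `β > b` multiplies the integrand by a decreasing
function of `cosh r`, which favours the region where `1 - a cosh r` is positive. The integral
becomes positive, that is, `K₁(β) > a K₂(β)`. -/
theorem besselRatio_strictMonoOn : StrictMonoOn besselRatio (Ioi 0) := by
  intro b hb β hβ hlt
  have hb : 0 < b := hb
  have hβ : 0 < β := hβ
  set a := besselRatio b with ha
  have ha0 : 0 < a := besselRatio_pos hb
  have hw : ∀ b : ℝ, 0 < b →
      IntegrableOn (fun r => (1 - a * Real.cosh r) * (Real.sinh r ^ 2 * Real.exp (-b * Real.cosh r)))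
        (Ioi 0) ∧
      ∫ r in Ioi (0 : ℝ), (1 - a * Real.cosh r) * (Real.sinh r ^ 2 * Real.exp (-b * Real.cosh r))
        = (besselK 1 b - a * besselK 2 b) / b := by
    intro b hb
    have h1 : (fun r => (1 - a * Real.cosh r) * (Real.sinh r ^ 2 * Real.exp (-b * Real.cosh r)))
      = fun r => Real.sinh r ^ 2 * Real.exp (-b * Real.cosh r)
        - a * (Real.sinh r ^ 2 * Real.cosh r * Real.exp (-b * Real.cosh r)) := by
      ext r; ring
    rw [h1]
    refine ⟨(integrableOn_sinh_sq hb).sub ((integrableOn_sinh_sq_cosh hb).const_mul a), ?_⟩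
    rw [integral_sub (integrableOn_sinh_sq hb) ((integrableOn_sinh_sq_cosh hb).const_mul a),
      integral_const_mul, integral_sinh_sq hb, integral_sinh_sq_cosh hb]
    ring
  obtain ⟨hi1, he1⟩ := hw b hb
  obtain ⟨hi2, he2⟩ := hw β hβ
  have hz : besselK 1 b - a * besselK 2 b = 0 := by
    rw [ha, besselRatio, div_mul_cancel₀ _ (besselK_pos 2 hb).ne', sub_self]
  rw [hz, zero_div] at he1
  -- `κ` is the value of `exp (-(β - b) cosh r)` where `1 - a cosh r` changes sign. Subtracting it
  -- gives the two factors the same sign everywhere, and costs nothing since the integral at `b` is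
  -- zero.
  set κ := Real.exp (-(β - b) * (1 / a)) with hκ
  have hnn : ∀ r, 0 ≤ (1 - a * Real.cosh r) * (Real.sinh r ^ 2 * Real.exp (-β * Real.cosh r))
      - κ * ((1 - a * Real.cosh r) * (Real.sinh r ^ 2 * Real.exp (-b * Real.cosh r))) ∧
      (0 < r → 1 - a * Real.cosh r ≠ 0 →
      0 ≠ (1 - a * Real.cosh r) * (Real.sinh r ^ 2 * Real.exp (-β * Real.cosh r))
      - κ * ((1 - a * Real.cosh r) * (Real.sinh r ^ 2 * Real.exp (-b * Real.cosh r)))) := by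
    intro r
    have he : Real.exp (-β * Real.cosh r)
        = Real.exp (-(β - b) * Real.cosh r) * Real.exp (-b * Real.cosh r) := by
      rw [← Real.exp_add]; congr 1; ring
    have h1 : (1 - a * Real.cosh r) * (Real.sinh r ^ 2 * Real.exp (-β * Real.cosh r))
      - κ * ((1 - a * Real.cosh r) * (Real.sinh r ^ 2 * Real.exp (-b * Real.cosh r)))
      = ((1 - a * Real.cosh r) * (Real.exp (-(β - b) * Real.cosh r) - κ)) *
        (Real.sinh r ^ 2 * Real.exp (-b * Real.cosh r)) := by
      rw [he]; ring
    rw [h1]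
    have hd : 0 < β - b := sub_pos.2 hlt
    rcases lt_trichotomy (1 - a * Real.cosh r) 0 with h | h | h
    · have : 1 / a < Real.cosh r := by rw [div_lt_iff₀ ha0]; linarith
      have h2 : Real.exp (-(β - b) * Real.cosh r) - κ < 0 := by
        rw [sub_neg, hκ, Real.exp_lt_exp]; nlinarith
      have h3 := mul_pos_of_neg_of_neg h h2
      exact ⟨by positivity, fun hr _ => by
        have := Real.sinh_pos_iff.2 hr; positivity⟩
    · simp [h]
    · have : Real.cosh r < 1 / a := by rw [lt_div_iff₀ ha0]; linarith
      have h2 : 0 < Real.exp (-(β - b) * Real.cosh r) - κ := by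
        rw [sub_pos, hκ, Real.exp_lt_exp]; nlinarith
      exact ⟨by positivity, fun hr _ => by
        have := Real.sinh_pos_iff.2 hr; positivity⟩
  have hpos : 0 < ∫ r in Ioi (0 : ℝ),
      ((1 - a * Real.cosh r) * (Real.sinh r ^ 2 * Real.exp (-β * Real.cosh r))
      - κ * ((1 - a * Real.cosh r) * (Real.sinh r ^ 2 * Real.exp (-b * Real.cosh r)))) := by
    rw [setIntegral_pos_iff_support_of_nonneg_ae (Eventually.of_forall fun r => (hnn r).1)
      (hi2.sub (hi1.const_mul κ))]
    -- For `r > 0` the integrand can vanish only where `a cosh r = 1`, so beyond that point there is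
    -- a half-line of positive measure.
    have hsub : Ioi (Real.arcosh (1 / a)) ∩ Ioi 0 ⊆ Function.support (fun r =>
      (1 - a * Real.cosh r) * (Real.sinh r ^ 2 * Real.exp (-β * Real.cosh r))
      - κ * ((1 - a * Real.cosh r) * (Real.sinh r ^ 2 * Real.exp (-b * Real.cosh r)))) ∩ Ioi 0 := by
      rintro r ⟨hr1, hr⟩
      refine ⟨((hnn r).2 hr fun h => ?_).symm, hr⟩
      have h1 : 1 / a = Real.cosh r := by rw [div_eq_iff ha0.ne']; linarith
      rw [h1, Real.arcosh_cosh (le_of_lt hr)] at hr1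
      exact lt_irrefl r hr1
    refine lt_of_lt_of_le ?_ (measure_mono hsub)
    rw [Ioi_inter_Ioi]; simp
  rw [integral_sub hi2 (hi1.const_mul κ), integral_const_mul, he1, he2, mul_zero, sub_zero] at hpos
  rw [besselRatio, lt_div_iff₀ (besselK_pos 2 hβ)]
  have := (div_pos_iff_of_pos_right hβ).1 hpos
  linarith

theorem besselRatio_lt_one {β : ℝ} (hβ : 0 < β) : besselRatio β < 1 := by
  rw [besselRatio, div_lt_one (besselK_pos 2 hβ)]
  refine sub_pos.1 ?_
  rw [besselK, besselK, ← integral_sub (integrableOn_besselK 2 hβ) (integrableOn_besselK 1 hβ)]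
  refine setIntegral_Ioi_pos ((integrableOn_besselK 2 hβ).sub (integrableOn_besselK 1 hβ))
    fun r hr => ?_
  rw [← sub_mul]
  refine mul_pos (sub_pos.2 (Real.cosh_lt_cosh.2 ?_)) (Real.exp_pos _)
  push_cast
  rw [abs_of_pos (by positivity), abs_of_pos (by positivity)]; linarith

theorem exists_besselRatio_eq {s : ℝ} (h0 : 0 < s) (h1 : s < 1) :
    ∃ β, 0 < β ∧ besselRatio β = s := by
  have hs : 0 < 1 - s := sub_pos.2 h1
  -- The interval `[s, 2 / (1 - s)]` suits the intermediate value theorem: the ratio is at most `s`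
  -- at the left end, and at least `1 - (1 - s) = s` at the right end.
  have hle : s ≤ 2 / (1 - s) := by
    rw [le_div_iff₀ hs]; nlinarith
  have hpos : 0 < 2 / (1 - s) := by positivity
  have hsub : Icc s (2 / (1 - s)) ⊆ Ioi 0 := fun x hx => h0.trans_le hx.1
  obtain ⟨β, hβ, h⟩ := intermediate_value_Icc hle (continuousOn_besselRatio.mono hsub)
    (show s ∈ Icc _ _ from ⟨besselRatio_le_self h0, by
      refine le_trans ?_ (le_besselRatio hpos)
      rw [div_div_cancel₀ (by norm_num : (2:ℝ) ≠ 0)]; linarith⟩)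
  exact ⟨β, hsub hβ, h⟩

/-! ### The mass hyperboloid and Lorentz boosts -/

/-- The Lorentz factor `√(1 + |p|²)`, the energy in units with `m = c = 1`. -/
noncomputable def lorentzFactor (p : E3) : ℝ := √(1 + ‖p‖ ^ 2)

theorem lorentzFactor_sq (p : E3) : lorentzFactor p ^ 2 = 1 + ‖p‖ ^ 2 :=
  Real.sq_sqrt (by positivity)

theorem lorentzFactor_pos (p : E3) : 0 < lorentzFactor p := Real.sqrt_pos.2 (by positivity)

theorem one_le_lorentzFactor (p : E3) : 1 ≤ lorentzFactor p := by
  rw [lorentzFactor, Real.one_le_sqrt]; nlinarith [sq_nonneg ‖p‖]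

theorem norm_lt_lorentzFactor (p : E3) : ‖p‖ < lorentzFactor p :=
  Real.lt_sqrt_of_sq_lt (by linarith)

theorem lorentzFactor_neg (p : E3) : lorentzFactor (-p) = lorentzFactor p := by
  simp [lorentzFactor]

theorem continuous_lorentzFactor : Continuous lorentzFactor := by
  unfold lorentzFactor; fun_prop

theorem lorentzFactor_mul_add_inner_pos (u p : E3) :
    0 < lorentzFactor u * lorentzFactor p + inner ℝ u p := by
  have h1 := abs_real_inner_le_norm u p
  have h2 := mul_lt_mul'' (norm_lt_lorentzFactor u) (norm_lt_lorentzFactor p) (norm_nonneg _)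
    (norm_nonneg _)
  linarith [neg_abs_le (inner ℝ u p)]

/-- The Lorentz boost with four-velocity `(√(1 + |u|²), u)`, acting on spatial momenta. -/
noncomputable def boost (u p : E3) : E3 :=
  p + (inner ℝ u p / (lorentzFactor u + 1) + lorentzFactor p) • u

theorem inner_boost (u p : E3) : inner ℝ u (boost u p)
    = lorentzFactor u * inner ℝ u p + lorentzFactor p * (lorentzFactor u ^ 2 - 1) := by
  have hu := lorentzFactor_pos u
  have h : ‖u‖ ^ 2 = lorentzFactor u ^ 2 - 1 := by rw [lorentzFactor_sq]; ring
  rw [boost, inner_add_right, inner_smul_right, real_inner_self_eq_norm_sq, h]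
  field_simp; ring

theorem lorentzFactor_boost (u p : E3) :
    lorentzFactor (boost u p) = lorentzFactor u * lorentzFactor p + inner ℝ u p := by
  have hu := lorentzFactor_pos u
  have h : ‖u‖ ^ 2 = lorentzFactor u ^ 2 - 1 := by rw [lorentzFactor_sq]; ring
  have h' : ‖p‖ ^ 2 = lorentzFactor p ^ 2 - 1 := by rw [lorentzFactor_sq]; ring
  rw [← sq_eq_sq₀ (lorentzFactor_pos _).le (lorentzFactor_mul_add_inner_pos u p).le,
    lorentzFactor_sq, boost, norm_add_sq_real, norm_smul, mul_pow, inner_smul_right,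
    real_inner_comm, Real.norm_eq_abs, sq_abs, h, h']
  field_simp; ring

/-- Invariance of the Minkowski product with the four-velocity: after a boost the Jüttner exponent
depends only on the rest-frame energy. -/
theorem lorentzFactor_boost_sub_inner (u p : E3) :
    lorentzFactor u * lorentzFactor (boost u p) - inner ℝ u (boost u p) = lorentzFactor p := by
  rw [lorentzFactor_boost, inner_boost]; ring

theorem boost_neg_boost (u p : E3) : boost (-u) (boost u p) = p := by
  have hu := lorentzFactor_pos u
  conv_lhs => rw [boost]
  rw [inner_neg_left, inner_boost, lorentzFactor_boost, lorentzFactor_neg, boost, smul_neg,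
    ← sub_eq_add_neg, add_sub_assoc, ← sub_smul]
  convert add_zero p
  rw [smul_eq_zero]; left
  field_simp; ring

theorem boost_injective (u : E3) : Function.Injective (boost u) :=
  Function.LeftInverse.injective (g := boost (-u)) (boost_neg_boost u)

theorem boost_surjective (u : E3) : Function.Surjective (boost u) := fun p =>
  ⟨boost (-u) p, by simpa using boost_neg_boost (-u) p⟩

theorem hasFDerivAt_lorentzFactor (p : E3) :
    HasFDerivAt lorentzFactor ((1 / lorentzFactor p) • innerSL ℝ p) p := by
  have h := ((hasStrictFDerivAt_norm_sq p).hasFDerivAt.const_add 1).sqrt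
    (by positivity : (1 + ‖p‖ ^ 2) ≠ 0)
  refine h.congr_fderiv ?_
  ext v
  simp [lorentzFactor]
  ring

/-- The derivative of a boost. -/
noncomputable def boostDeriv (u p : E3) : E3 →L[ℝ] E3 :=
  ContinuousLinearMap.id ℝ E3 + ((1 / (lorentzFactor u + 1)) • innerSL ℝ u
    + (1 / lorentzFactor p) • innerSL ℝ p).smulRight u

theorem hasFDerivAt_boost (u p : E3) : HasFDerivAt (boost u) (boostDeriv u p) p := by
  have h1 : HasFDerivAt (fun p : E3 => inner ℝ u p / (lorentzFactor u + 1))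
      ((1 / (lorentzFactor u + 1)) • innerSL ℝ u) p := by
    refine (((innerSL ℝ u).hasFDerivAt (x := p)).const_mul (1 / (lorentzFactor u + 1))).congr_of_eventuallyEq
      (Eventually.of_forall fun p => ?_)
    simp; ring
  exact (hasFDerivAt_id p).add ((h1.add (hasFDerivAt_lorentzFactor p)).smul_const u)

/-- The derivative is the identity plus a rank-one map, so its determinant is one plus the linear
form evaluated at `u`. That it is a quotient of energies is the reason for the invariance of `dp /
√(1 + |p|²)`. -/
theorem det_boostDeriv (u p : E3) :
    (boostDeriv u p).det = lorentzFactor (boost u p) / lorentzFactor p := by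
  have hu := lorentzFactor_pos u
  have hp := lorentzFactor_pos p
  have h : ‖u‖ ^ 2 = lorentzFactor u ^ 2 - 1 := by rw [lorentzFactor_sq]; ring
  have h1 : ((boostDeriv u p : E3 →L[ℝ] E3) : E3 →ₗ[ℝ] E3) = LinearMap.transvection
      (((1 / (lorentzFactor u + 1)) • innerSL ℝ u
        + (1 / lorentzFactor p) • innerSL ℝ p : E3 →L[ℝ] ℝ) : E3 →ₗ[ℝ] ℝ) u := by
    ext v
    simp [boostDeriv, LinearMap.transvection.apply]
  rw [ContinuousLinearMap.det, h1, LinearMap.transvection.det, lorentzFactor_boost]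
  simp only [ContinuousLinearMap.coe_coe, add_apply, smul_apply,
    innerSL_apply_apply, smul_eq_mul, real_inner_self_eq_norm_sq, h, real_inner_comm]
  field_simp; ring

theorem abs_det_boostDeriv_mul (F : E3 → ℝ) (u p : E3) :
    |(boostDeriv u p).det| • (F (boost u p) / lorentzFactor (boost u p))
      = F (boost u p) / lorentzFactor p := by
  have h1 := lorentzFactor_pos (boost u p)
  have h2 := lorentzFactor_pos p
  rw [det_boostDeriv, abs_of_pos (by positivity), smul_eq_mul]
  field_simp

/-- The measure `dp / √(1 + |p|²)` is invariant under boosts. -/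
theorem integral_comp_boost (F : E3 → ℝ) (u : E3) :
    ∫ p, F p / lorentzFactor p = ∫ p, F (boost u p) / lorentzFactor p := by
  have := integral_image_eq_integral_abs_det_fderiv_smul volume MeasurableSet.univ
    (fun p _ => (hasFDerivAt_boost u p).hasFDerivWithinAt) (boost_injective u).injOn
    (fun p => F p / lorentzFactor p)
  rw [image_univ, (boost_surjective u).range_eq, setIntegral_univ, setIntegral_univ] at this
  simpa only [abs_det_boostDeriv_mul] using this

theorem integrable_comp_boost_iff (F : E3 → ℝ) (u : E3) :
    Integrable (fun p => F p / lorentzFactor p)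
      ↔ Integrable (fun p => F (boost u p) / lorentzFactor p) := by
  have := integrableOn_image_iff_integrableOn_abs_det_fderiv_smul volume MeasurableSet.univ
    (fun p _ => (hasFDerivAt_boost u p).hasFDerivWithinAt) (boost_injective u).injOn
    (fun p => F p / lorentzFactor p)
  rw [image_univ, (boost_surjective u).range_eq, integrableOn_univ, integrableOn_univ] at this
  simpa only [abs_det_boostDeriv_mul] using this

/-! ### Equilibrium integrals in the rest frame -/

theorem integrable_exp_neg_lorentzFactor {β : ℝ} (hβ : 0 < β) :
    Integrable (fun p : E3 => Real.exp (-β * lorentzFactor p)) := by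
  -- The exponent `4` exceeds the dimension `3`; the constant comes from `x ^ 4 / 4! ≤ exp x` at `x
  -- = (β / 2) (1 + ‖p‖)`.
  have h0 : Integrable (fun p : E3 => (4).factorial / (β / 2) ^ 4 * (1 + ‖p‖) ^ (-(4 : ℝ))) :=
    (integrable_one_add_norm (by simp; norm_num)).const_mul _
  have hc := continuous_lorentzFactor
  refine h0.mono' (Continuous.aestronglyMeasurable (by fun_prop)) (Eventually.of_forall fun p => ?_)
  have h1 : β / 2 * (1 + ‖p‖) ≤ β * lorentzFactor p := by
    nlinarith [one_le_lorentzFactor p, norm_lt_lorentzFactor p]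
  have h2 := (Real.pow_div_factorial_le_exp (β / 2 * (1 + ‖p‖)) (by positivity) 4).trans
    (Real.exp_le_exp.2 h1)
  have h3 : (1 + ‖p‖) ^ (-(4 : ℝ)) = ((1 + ‖p‖) ^ 4)⁻¹ := by
    rw [Real.rpow_neg (by positivity)]; norm_cast
  rw [Real.norm_eq_abs, Real.abs_exp, h3, neg_mul, Real.exp_neg, inv_le_comm₀ (Real.exp_pos _)
    (by positivity)]
  refine le_trans (le_of_eq ?_) h2
  rw [mul_pow]
  field_simp

theorem integrable_mul_exp_neg_lorentzFactor {β : ℝ} (hβ : 0 < β) {g : E3 → ℝ}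
    (hg : Continuous g) {C : ℝ} (h : ∀ p, |g p| ≤ C * lorentzFactor p) :
    Integrable (fun p : E3 => g p * Real.exp (-β * lorentzFactor p) / lorentzFactor p) := by
  have hc := continuous_lorentzFactor
  refine ((integrable_exp_neg_lorentzFactor hβ).const_mul C).mono'
    (Continuous.aestronglyMeasurable
      (Continuous.div (by fun_prop) hc fun p => (lorentzFactor_pos p).ne'))
    (Eventually.of_forall fun p => ?_)
  have hp := lorentzFactor_pos p
  rw [Real.norm_eq_abs, abs_div, abs_mul, Real.abs_exp, abs_of_pos hp, div_le_iff₀ hp]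
  calc |g p| * Real.exp (-β * lorentzFactor p)
      ≤ C * lorentzFactor p * Real.exp (-β * lorentzFactor p) := by gcongr; exact h p
    _ = _ := by ring

theorem integral_eq_zero_of_odd {g : E3 → ℝ} (h : ∀ p, g (-p) = -g p) : ∫ p, g p = 0 := by
  have h1 := integral_neg_eq_self g volume
  simp only [h, integral_neg] at h1
  linarith

/-- Integrals of radial functions over the mass hyperboloid. -/
theorem integral_fun_lorentzFactor (F : ℝ → ℝ) :
    ∫ p : E3, F (lorentzFactor p) = (3 * volume.real (Metric.ball (0 : E3) 1)) *
      ∫ r in Ioi (0 : ℝ), Real.sinh r ^ 2 * Real.cosh r * F (Real.cosh r) := by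
  have h1 := integral_fun_norm_addHaar (volume : Measure E3) (fun y => F (√(1 + y ^ 2)))
  simp only [finrank_euclideanSpace, Fintype.card_fin, nsmul_eq_mul, smul_eq_mul] at h1
  have himg : Real.sinh '' Ioi 0 = Ioi 0 := by
    ext y
    refine ⟨?_, fun hy => ⟨Real.arsinh y, Real.arsinh_pos_iff.2 hy, Real.sinh_arsinh y⟩⟩
    rintro ⟨r, hr, rfl⟩
    exact Real.sinh_pos_iff.2 hr
  -- The substitution `|p| = sinh r` turns the energy into `cosh r`.
  have h2 := integral_image_eq_integral_abs_deriv_smul (s := Ioi 0) (f := Real.sinh)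
    (f' := Real.cosh) measurableSet_Ioi (fun r _ => (Real.hasDerivAt_sinh r).hasDerivWithinAt)
    Real.sinh_injective.injOn (fun y => y ^ 2 * F (√(1 + y ^ 2)))
  rw [himg] at h2
  simp only [lorentzFactor]
  rw [h1, mul_assoc]
  norm_num only [Nat.cast_ofNat]
  congr 2
  rw [h2]
  congr 1; ext r
  rw [abs_of_pos (Real.cosh_pos r), add_comm, ← Real.cosh_sq, Real.sqrt_sq (Real.cosh_pos r).le,
    smul_eq_mul]
  ring

theorem volume_ball_pos : 0 < 3 * volume.real (Metric.ball (0 : E3) 1) :=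
  mul_pos (by norm_num) (ENNReal.toReal_pos (Metric.measure_ball_pos _ _ one_pos).ne'
    measure_ball_lt_top.ne)

theorem juttnerMass_eq {β : ℝ} (hβ : 0 < β) : juttnerMass β
    = (3 * volume.real (Metric.ball (0 : E3) 1)) * (besselK 2 β / β) := by
  rw [← integral_sinh_sq_cosh hβ]
  exact integral_fun_lorentzFactor fun e => Real.exp (-β * e)

theorem integral_exp_neg_div {β : ℝ} (hβ : 0 < β) :
    ∫ p : E3, Real.exp (-β * lorentzFactor p) / lorentzFactor p
    = (3 * volume.real (Metric.ball (0 : E3) 1)) * (besselK 1 β / β) := by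
  rw [← integral_sinh_sq hβ, integral_fun_lorentzFactor fun e => Real.exp (-β * e) / e]
  congr 2; ext r
  have := Real.cosh_pos r
  field_simp

theorem juttnerMass_pos {β : ℝ} (hβ : 0 < β) : 0 < juttnerMass β := by
  rw [juttnerMass_eq hβ]
  exact mul_pos volume_ball_pos (div_pos (besselK_pos 2 hβ) hβ)

/-- The surface constant `3 vol(B)` is common to both integrals, so its value is never needed. -/
theorem integral_exp_neg_div_eq {β : ℝ} (hβ : 0 < β) :
    ∫ p : E3, Real.exp (-β * lorentzFactor p) / lorentzFactor p
      = juttnerMass β * besselRatio β := by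
  have := besselK_pos 2 hβ
  rw [integral_exp_neg_div hβ, juttnerMass_eq hβ, besselRatio]
  field_simp

/-! ### Moments of Jüttner distributions -/

theorem energy_pos {m c : ℝ} (hm : 0 < m) (hc : 0 < c) (q : E3) : 0 < energy m c q := by
  unfold energy; positivity

theorem energy_smul {m c : ℝ} (hm : 0 < m) (hc : 0 < c) (p : E3) :
    energy m c ((m * c) • p) = m * c ^ 2 * lorentzFactor p := by
  rw [energy, lorentzFactor, norm_smul, Real.norm_eq_abs, mul_pow |m * c|, sq_abs,
    show (m * c) ^ 2 + (m * c) ^ 2 * ‖p‖ ^ 2 = (m * c) ^ 2 * (1 + ‖p‖ ^ 2) by ring,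
    Real.sqrt_mul (by positivity), Real.sqrt_sq (by positivity)]
  ring

theorem contract_eq (v w : Fin 4 → ℝ) :
    contract v w = v 0 * w 0 - (v 1 * w 1 + v 2 * w 2 + v 3 * w 3) := by
  simp [contract, lower, metric, Fin.sum_univ_four]
  ring

theorem inner_eq (u q : E3) : inner ℝ u q = u 0 * q 0 + u 1 * q 1 + u 2 * q 2 := by
  simp [PiLp.inner_apply, Fin.sum_univ_three]
  ring

@[simp] theorem fourMomentum_zero (m c : ℝ) (q : E3) : fourMomentum m c q 0 = energy m c q := rfl

@[simp] theorem fourMomentum_succ (m c : ℝ) (q : E3) (i : Fin 3) :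
    fourMomentum m c q i.succ = c * q i := rfl

theorem contract_fourVelocity_fourMomentum (m c : ℝ) (u q : E3) :
    contract (fourVelocity u) (fourMomentum m c q)
      = lorentzFactor u * energy m c q - c * inner ℝ u q := by
  rw [contract_eq, inner_eq]
  change lorentzFactor u * energy m c q
    - (u 0 * (c * q 0) + u 1 * (c * q 1) + u 2 * (c * q 2)) = _
  ring

theorem juttner_eq {m c : ℝ} (hm : 0 < m) (hc : 0 < c) (n β : ℝ) (u p : E3) :
    juttner m c n β u ((m * c) • p) = n / ((m * c) ^ 3 * juttnerMass β) *
      Real.exp (-β * (lorentzFactor u * lorentzFactor p - inner ℝ u p)) := by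
  rw [juttner, contract_fourVelocity_fourMomentum, energy_smul hm hc, inner_smul_right]
  congr 2
  field_simp

theorem juttner_integrand {m c : ℝ} (hm : 0 < m) (hc : 0 < c) (n β : ℝ) (u : E3) (F : E3 → ℝ)
    (p : E3) : F ((m * c) • p) * juttner m c n β u ((m * c) • p) / energy m c ((m * c) • p)
      = n / ((m * c) ^ 3 * juttnerMass β) / (m * c ^ 2) *
        (F ((m * c) • p) * Real.exp (-β * (lorentzFactor u * lorentzFactor p - inner ℝ u p))
          / lorentzFactor p) := by
  have := lorentzFactor_pos p
  rw [juttner_eq hm hc, energy_smul hm hc]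
  field_simp

/-- Passage to the rest frame in the integrals of a Jüttner distribution. -/
theorem integral_mul_juttner {m c : ℝ} (hm : 0 < m) (hc : 0 < c) (n β : ℝ) (u : E3)
    (F : E3 → ℝ) : ∫ q, F q * juttner m c n β u q / energy m c q
      = n / (juttnerMass β * (m * c ^ 2)) * ∫ p, F ((m * c) • boost u p) *
        Real.exp (-β * lorentzFactor p) / lorentzFactor p := by
  have hmc : 0 < m * c := by positivity
  have h1 := Measure.integral_comp_smul (volume : Measure E3)
    (fun q => F q * juttner m c n β u q / energy m c q) (m * c)
  simp only [finrank_euclideanSpace, Fintype.card_fin, smul_eq_mul, abs_inv,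
    abs_of_pos (pow_pos hmc 3)] at h1
  rw [inv_mul_eq_div, eq_div_iff (by positivity)] at h1
  rw [← h1]
  simp only [juttner_integrand hm hc]
  rw [integral_const_mul, integral_comp_boost _ u]
  simp only [lorentzFactor_boost_sub_inner]
  field_simp

theorem integrable_mul_juttner {m c : ℝ} (hm : 0 < m) (hc : 0 < c) (n β : ℝ) (u : E3)
    {F : E3 → ℝ} (h : Integrable (fun p => F ((m * c) • boost u p) *
        Real.exp (-β * lorentzFactor p) / lorentzFactor p)) :
    Integrable (fun q => F q * juttner m c n β u q / energy m c q) := by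
  have hmc : 0 < m * c := by positivity
  rw [← integrable_comp_smul_iff volume _ hmc.ne']
  simp only [juttner_integrand hm hc]
  refine Integrable.const_mul ?_ _
  rw [integrable_comp_boost_iff _ u]
  simpa only [lorentzFactor_boost_sub_inner] using h

theorem integrable_juttner_div_energy {m c : ℝ} (hm : 0 < m) (hc : 0 < c) (n : ℝ) {β : ℝ}
    (hβ : 0 < β) (u : E3) : Integrable (fun q => juttner m c n β u q / energy m c q) := by
  have := integrable_mul_juttner hm hc n β u (F := fun _ => 1)
    (integrable_mul_exp_neg_lorentzFactor hβ (g := fun _ => 1) continuous_const (C := 1)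
      fun p => by simpa using one_le_lorentzFactor p)
  simpa using this

theorem scalarMoment_juttner {m c : ℝ} (hm : 0 < m) (hc : 0 < c) (n : ℝ) {β : ℝ}
    (hβ : 0 < β) (u : E3) :
    scalarMoment m c (juttner m c n β u) = n / (m * c ^ 2) * besselRatio β := by
  have := integral_mul_juttner hm hc n β u (fun _ => 1)
  simp only [one_mul] at this
  have h := juttnerMass_pos hβ
  rw [scalarMoment, this, integral_exp_neg_div_eq hβ]
  field_simp

theorem abs_apply_le_norm (p : E3) (i : Fin 3) : |p i| ≤ ‖p‖ := by
  simpa using PiLp.norm_apply_le p i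

/-- Each component of a boosted four-momentum is a linear form in `p` plus a multiple of the energy.
The linear form is odd and integrates to zero; the energy cancels the denominator and produces
`M(β)`. -/
theorem particleFlux_juttner_aux {m c : ℝ} (hm : 0 < m) (hc : 0 < c) (n : ℝ) {β : ℝ}
    (hβ : 0 < β) (u : E3) (F : E3 → ℝ) (L : E3 →L[ℝ] ℝ) (v : ℝ)
    (hF : ∀ p, F ((m * c) • boost u p) = m * c ^ 2 * (L p + v * lorentzFactor p)) :
    Integrable (fun q => F q * juttner m c n β u q / energy m c q) ∧
    ∫ q, F q * juttner m c n β u q / energy m c q = n * v := by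
  have hM := juttnerMass_pos hβ
  have e1 : (fun p => F ((m * c) • boost u p) * Real.exp (-β * lorentzFactor p) / lorentzFactor p)
      = fun p => m * c ^ 2 * (L p * Real.exp (-β * lorentzFactor p) / lorentzFactor p) +
        m * c ^ 2 * v * Real.exp (-β * lorentzFactor p) := by
    ext p
    have := lorentzFactor_pos p
    rw [hF]; field_simp
  have i1 : Integrable (fun p => L p * Real.exp (-β * lorentzFactor p) / lorentzFactor p) :=
    integrable_mul_exp_neg_lorentzFactor hβ L.continuous (C := ‖L‖) fun p =>
      (L.le_opNorm p).trans (by gcongr; exact (norm_lt_lorentzFactor p).le)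
  have i2 := integrable_exp_neg_lorentzFactor hβ
  have z : ∫ p, L p * Real.exp (-β * lorentzFactor p) / lorentzFactor p = 0 :=
    integral_eq_zero_of_odd fun p => by rw [lorentzFactor_neg, map_neg]; ring
  refine ⟨integrable_mul_juttner hm hc n β u ?_, ?_⟩
  · rw [e1]; exact (i1.const_mul _).add (i2.const_mul _)
  · rw [integral_mul_juttner hm hc, e1, integral_add (i1.const_mul _) (i2.const_mul _),
      integral_const_mul, integral_const_mul, z]
    change _ * (_ + _ * juttnerMass β) = _
    field_simp; ring

theorem particleFlux_juttner {m c : ℝ} (hm : 0 < m) (hc : 0 < c) (n : ℝ) {β : ℝ}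
    (hβ : 0 < β) (u : E3) (μ : Fin 4) :
    Integrable (fun q => fourMomentum m c q μ * juttner m c n β u q / energy m c q) ∧
    particleFlux m c (juttner m c n β u) μ = n * fourVelocity u μ := by
  refine Fin.cases ?_ (fun i => ?_) μ
  · refine particleFlux_juttner_aux hm hc n hβ u _ (innerSL ℝ u) (lorentzFactor u) fun p => ?_
    rw [fourMomentum_zero, energy_smul hm hc, lorentzFactor_boost, innerSL_apply_apply]
    ring
  · refine particleFlux_juttner_aux hm hc n hβ u _
      (EuclideanSpace.proj i + (u i / (lorentzFactor u + 1)) • innerSL ℝ u) (u i) fun p => ?_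
    rw [fourMomentum_succ, boost]
    simp
    ring

/-! ### Existence and uniqueness of the local equilibrium -/

/-- The spatial part of the particle flux. -/
noncomputable def fluxVector (m c : ℝ) (f : E3 → ℝ) : E3 :=
  WithLp.toLp 2 fun i : Fin 3 => particleFlux m c f i.succ

theorem velocity_eq (m c : ℝ) (f : E3 → ℝ) :
    velocity m c f = (properDensity m c f)⁻¹ • fluxVector m c f := by
  ext i
  simp [velocity, fluxVector, div_eq_inv_mul]

theorem contract_cons_fourMomentum (m c t : ℝ) (w q : E3) :
    contract (Fin.cons t fun i : Fin 3 => w i) (fourMomentum m c q)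
      = t * energy m c q - c * inner ℝ w q := by
  rw [contract_eq, inner_eq]
  change t * energy m c q
    - (w 0 * (c * q 0) + w 1 * (c * q 1) + w 2 * (c * q 2)) = _
  ring

theorem contract_cons_particleFlux (m c t : ℝ) (w : E3) (f : E3 → ℝ) :
    contract (Fin.cons t fun i : Fin 3 => w i) (particleFlux m c f)
      = t * particleFlux m c f 0 - inner ℝ w (fluxVector m c f) := by
  rw [contract_eq, inner_eq]
  rfl

theorem contract_particleFlux_self (m c : ℝ) (f : E3 → ℝ) :
    contract (particleFlux m c f) (particleFlux m c f)
      = particleFlux m c f 0 ^ 2 - ‖fluxVector m c f‖ ^ 2 := by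
  rw [contract_eq, ← real_inner_self_eq_norm_sq, inner_eq, sq]
  rfl

/-! ### Timelike flux, admissible scalar moments, and the equilibrium of a given density. -/

section Moments

variable {m c : ℝ} {f : E3 → ℝ}

theorem contract_particleFlux (hf : HasMoments m c f) (a : Fin 4 → ℝ) :
    Integrable (fun q => contract a (fourMomentum m c q) * f q / energy m c q) ∧
    ∫ q, contract a (fourMomentum m c q) * f q / energy m c q
      = contract a (particleFlux m c f) := by
  have h : (fun q => contract a (fourMomentum m c q) * f q / energy m c q)
      = fun q => ∑ μ, lower a μ * (fourMomentum m c q μ * f q / energy m c q) := by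
    ext q
    rw [contract, Finset.sum_mul, Finset.sum_div]
    exact Finset.sum_congr rfl fun μ _ => by ring
  have hi : ∀ μ ∈ Finset.univ, Integrable
      (fun q => lower a μ * (fourMomentum m c q μ * f q / energy m c q)) :=
    fun μ _ => (hf.1 μ).const_mul _
  rw [h]
  refine ⟨integrable_finsetSum _ hi, ?_⟩
  rw [integral_finsetSum _ hi, contract]
  exact Finset.sum_congr rfl fun μ _ => by rw [integral_const_mul]; rfl

theorem le_energy (hc : 0 < c) (q : E3) : m * c ^ 2 ≤ energy m c q := by
  have : m * c ≤ √((m * c) ^ 2 + ‖q‖ ^ 2) := Real.le_sqrt_of_sq_le (by nlinarith [sq_nonneg ‖q‖])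
  rw [energy]
  nlinarith

theorem mul_norm_lt_energy (hm : 0 < m) (hc : 0 < c) (q : E3) : c * ‖q‖ < energy m c q := by
  rw [energy]
  gcongr
  exact Real.lt_sqrt_of_sq_lt (by have := mul_pos hm hc; nlinarith)

theorem continuous_energy (m c : ℝ) : Continuous (energy m c) := by
  unfold energy; fun_prop

theorem HasMoments.integrable_self (hm : 0 < m) (hc : 0 < c) (hf : HasMoments m c f) :
    Integrable f := by
  refine (hf.1 0).congr (Eventually.of_forall fun q => ?_)
  have := energy_pos hm hc q
  simp only [fourMomentum_zero]
  field_simp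

theorem integrable_div_energy (hm : 0 < m) (hc : 0 < c) (hf : Integrable f) :
    Integrable (fun q => f q / energy m c q) := by
  have hmc : 0 < m * c ^ 2 := by positivity
  refine (hf.norm.const_mul (m * c ^ 2)⁻¹).mono'
    (hf.aestronglyMeasurable.div₀ (continuous_energy m c).aestronglyMeasurable)
    (Eventually.of_forall fun q => ?_)
  rw [norm_div, Real.norm_eq_abs (energy m c q), abs_of_pos (energy_pos hm hc q), inv_mul_eq_div]
  gcongr
  exact le_energy hc q

theorem integral_mul_pos_of_ae {α : Type*} [MeasurableSpace α] {μ : Measure α} {g f : α → ℝ}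
    (hg : ∀ᵐ q ∂μ, 0 < g q) (h0 : ∀ᵐ q ∂μ, 0 ≤ f q) (h1 : ¬ ∀ᵐ q ∂μ, f q = 0)
    (hi : Integrable (fun q => g q * f q) μ) : 0 < ∫ q, g q * f q ∂μ := by
  have hnn : 0 ≤ᵐ[μ] fun q => g q * f q := by
    filter_upwards [hg, h0] with q h h' using mul_nonneg h.le h'
  refine lt_of_le_of_ne (integral_nonneg_of_ae hnn) fun h => h1 ?_
  have := (integral_eq_zero_iff_of_nonneg_ae hnn hi).1 h.symm
  filter_upwards [this, hg] with q h h'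
  exact (mul_eq_zero.1 h).resolve_left h'.ne'

/-- With `w` the direction of the spatial flux, the difference of the two sides is the integral of
`(q^0 - c w · q) f / q^0`, whose weight is positive because `|w| ≤ 1` and `c |q| < q^0`. -/
theorem norm_fluxVector_lt (hm : 0 < m) (hc : 0 < c) (h0 : ∀ᵐ q, 0 ≤ f q)
    (h1 : ¬ ∀ᵐ q, f q = 0) (hf : HasMoments m c f) :
    ‖fluxVector m c f‖ < particleFlux m c f 0 := by
  -- If the flux vector is zero then `w = 0`, hence only `‖w‖ ≤ 1` is claimed.
  set w := ‖fluxVector m c f‖⁻¹ • fluxVector m c f with hw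
  have hw1 : ‖w‖ ≤ 1 := by
    rw [hw, norm_smul, norm_inv, norm_norm]; exact inv_mul_le_one
  have hwN : inner ℝ w (fluxVector m c f) = ‖fluxVector m c f‖ := by
    rw [hw, real_inner_smul_left, real_inner_self_eq_norm_sq]
    by_cases h : ‖fluxVector m c f‖ = 0
    · simp [h]
    · field_simp
  obtain ⟨hi, he⟩ := contract_particleFlux hf (Fin.cons 1 fun i : Fin 3 => w i)
  rw [contract_cons_particleFlux, hwN, one_mul] at he
  simp only [contract_cons_fourMomentum, one_mul, mul_div_right_comm] at hi he
  refine sub_pos.1 (he ▸ integral_mul_pos_of_ae (Eventually.of_forall fun q => ?_) h0 h1 hi)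
  refine div_pos (sub_pos.2 ?_) (energy_pos hm hc q)
  refine lt_of_le_of_lt ?_ (mul_norm_lt_energy hm hc q)
  gcongr
  exact (real_inner_le_norm w q).trans (mul_le_of_le_one_left (norm_nonneg _) hw1)

theorem properDensity_sq (hm : 0 < m) (hc : 0 < c) (h0 : ∀ᵐ q, 0 ≤ f q)
    (h1 : ¬ ∀ᵐ q, f q = 0) (hf : HasMoments m c f) :
    properDensity m c f ^ 2 = particleFlux m c f 0 ^ 2 - ‖fluxVector m c f‖ ^ 2 ∧
    0 < properDensity m c f := by
  have h := norm_fluxVector_lt hm hc h0 h1 hf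
  have hp : 0 < particleFlux m c f 0 ^ 2 - ‖fluxVector m c f‖ ^ 2 := by
    nlinarith [norm_nonneg (fluxVector m c f)]
  rw [properDensity, contract_particleFlux_self]
  exact ⟨Real.sq_sqrt hp.le, Real.sqrt_pos.2 hp⟩

theorem lorentzFactor_velocity (hm : 0 < m) (hc : 0 < c) (h0 : ∀ᵐ q, 0 ≤ f q)
    (h1 : ¬ ∀ᵐ q, f q = 0) (hf : HasMoments m c f) :
    properDensity m c f * lorentzFactor (velocity m c f) = particleFlux m c f 0 := by
  obtain ⟨h2, hn⟩ := properDensity_sq hm hc h0 h1 hf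
  have hN := (norm_nonneg _).trans_lt (norm_fluxVector_lt hm hc h0 h1 hf)
  have := lorentzFactor_pos (velocity m c f)
  rw [← sq_eq_sq₀ (by positivity) hN.le, mul_pow, lorentzFactor_sq, velocity_eq, norm_smul,
    norm_inv, mul_pow, inv_pow, Real.norm_eq_abs, sq_abs, mul_add,
    mul_inv_cancel_left₀ (by positivity), h2]
  ring

theorem particleFlux_eq (hm : 0 < m) (hc : 0 < c) (h0 : ∀ᵐ q, 0 ≤ f q)
    (h1 : ¬ ∀ᵐ q, f q = 0) (hf : HasMoments m c f) (μ : Fin 4) :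
    particleFlux m c f μ = properDensity m c f * fourVelocity (velocity m c f) μ := by
  have hn := (properDensity_sq hm hc h0 h1 hf).2
  refine Fin.cases (lorentzFactor_velocity hm hc h0 h1 hf).symm (fun i => ?_) μ
  change _ = _ * (velocity m c f) i
  simp only [velocity]
  field_simp

theorem one_lt_lorentzFactor {p : E3} (hp : p ≠ 0) : 1 < lorentzFactor p := by
  have := norm_pos_iff.2 hp
  exact Real.lt_sqrt_of_sq_lt (by nlinarith)

/-- Divided by `m c²`, the right side is the Lorentz factor of `q / (m c)` boosted by `-u`. It
exceeds `1` unless the boosted momentum is zero, which happens for at most one `q`. -/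
theorem ae_lt_contract_fourVelocity (hm : 0 < m) (hc : 0 < c) (u : E3) :
    ∀ᵐ q : E3, m * c ^ 2 < lorentzFactor u * energy m c q - c * inner ℝ u q := by
  have hmc : 0 < m * c := mul_pos hm hc
  have hs : {q : E3 | boost (-u) ((m * c)⁻¹ • q) = 0}.Subsingleton := by
    intro q hq q' hq'
    have := boost_injective (-u) (Eq.trans hq (Eq.symm hq'))
    exact smul_right_injective _ (inv_ne_zero hmc.ne') this
  have hnull : ∀ᵐ q : E3, ¬ boost (-u) ((m * c)⁻¹ • q) = 0 := by
    rw [ae_iff]; simpa using hs.measure_zero volume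
  filter_upwards [hnull] with q hq
  obtain ⟨p, rfl⟩ : ∃ p, q = (m * c) • p := ⟨(m * c)⁻¹ • q, by rw [smul_inv_smul₀ hmc.ne']⟩
  rw [inv_smul_smul₀ hmc.ne'] at hq
  have h := one_lt_lorentzFactor hq
  rw [lorentzFactor_boost, lorentzFactor_neg, inner_neg_left] at h
  rw [energy_smul hm hc, inner_smul_right]
  have : 0 < m * c ^ 2 := by positivity
  nlinarith

/-- Since `n_f = u_μ N^μ` for `u = u_f`, the gap in the second inequality is the integral of `(u_μ
q^μ - m c²) f / q^0`, with weight positive almost everywhere. So the equation for `β` has its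
right-hand side in `(0, 1)`. -/
theorem scalarMoment_lt (hm : 0 < m) (hc : 0 < c) (h0 : ∀ᵐ q, 0 ≤ f q)
    (h1 : ¬ ∀ᵐ q, f q = 0) (hf : HasMoments m c f) :
    0 < scalarMoment m c f ∧ m * c ^ 2 * scalarMoment m c f < properDensity m c f := by
  obtain ⟨h2, hn⟩ := properDensity_sq hm hc h0 h1 hf
  have hS := integrable_div_energy hm hc (hf.integrable_self hm hc)
  constructor
  · have := integral_mul_pos_of_ae (g := fun q => 1 / energy m c q) (f := f)
      (Eventually.of_forall fun q => one_div_pos.2 (energy_pos hm hc q)) h0 h1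
      (by simpa only [one_div_mul_eq_div] using hS)
    simpa only [one_div_mul_eq_div, scalarMoment] using this
  · set u := velocity m c f with hu
    obtain ⟨hi, he⟩ := contract_particleFlux hf (Fin.cons (lorentzFactor u) fun i : Fin 3 => u i)
    have hval : contract (Fin.cons (lorentzFactor u) fun i : Fin 3 => u i) (particleFlux m c f)
        = properDensity m c f := by
      rw [contract_cons_particleFlux, hu]
      nth_rewrite 2 [velocity_eq]
      rw [real_inner_smul_left,
        real_inner_self_eq_norm_sq, ← lorentzFactor_velocity hm hc h0 h1 hf]
      rw [← lorentzFactor_velocity hm hc h0 h1 hf] at h2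
      have : ‖fluxVector m c f‖ ^ 2 = properDensity m c f ^ 2 * (lorentzFactor u ^ 2 - 1) := by
        rw [mul_pow] at h2; linarith
      rw [this]
      field_simp
      ring
    rw [hval] at he
    simp only [contract_cons_fourMomentum] at hi he
    rw [← sub_pos, ← he, scalarMoment, ← integral_const_mul, ← integral_sub hi (hS.const_mul _)]
    have e : (fun q => (lorentzFactor u * energy m c q - c * inner ℝ u q) * f q / energy m c q
        - m * c ^ 2 * (f q / energy m c q)) = fun q =>
        ((lorentzFactor u * energy m c q - c * inner ℝ u q - m * c ^ 2) / energy m c q) * f q := by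
      ext q; ring
    have hi' := hi.sub (hS.const_mul (m * c ^ 2))
    have hi'' : Integrable (fun q => ((lorentzFactor u * energy m c q - c * inner ℝ u q - m * c ^ 2)
        / energy m c q) * f q) := by
      rw [← e]; exact hi'
    rw [e]
    refine integral_mul_pos_of_ae ?_ h0 h1 hi''
    filter_upwards [ae_lt_contract_fourVelocity hm hc u] with q hq
    exact div_pos (sub_pos.2 hq) (energy_pos hm hc q)

theorem existsUnique_solvesBetaEq (hm : 0 < m) (hc : 0 < c) (h0 : ∀ᵐ q, 0 ≤ f q)
    (h1 : ¬ ∀ᵐ q, f q = 0) (hf : HasMoments m c f) : ∃! β : ℝ, SolvesBetaEq m c f β := by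
  have hn := (properDensity_sq hm hc h0 h1 hf).2
  obtain ⟨hS, hlt⟩ := scalarMoment_lt hm hc h0 h1 hf
  have hmc : 0 < m * c ^ 2 := by positivity
  obtain ⟨β, hβ, h⟩ := exists_besselRatio_eq
    (s := m * c ^ 2 / properDensity m c f * scalarMoment m c f) (by positivity)
    (by rwa [div_mul_eq_mul_div, div_lt_one hn])
  exact ⟨β, ⟨hβ, h⟩, fun β' hβ' =>
    besselRatio_strictMonoOn.injOn hβ'.1 hβ (hβ'.2.trans h.symm)⟩

theorem solvesBetaEq_beta (hm : 0 < m) (hc : 0 < c) (h0 : ∀ᵐ q, 0 ≤ f q)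
    (h1 : ¬ ∀ᵐ q, f q = 0) (hf : HasMoments m c f) : SolvesBetaEq m c f (beta m c f) :=
  Classical.epsilon_spec (existsUnique_solvesBetaEq hm hc h0 h1 hf).exists

theorem sameMoments_localJuttner_of_ne_zero (hm : 0 < m) (hc : 0 < c) (h0 : ∀ᵐ q, 0 ≤ f q)
    (h1 : ¬ ∀ᵐ q, f q = 0) (hf : HasMoments m c f) :
    SameMoments m c f (localJuttner m c f) := by
  have hn := (properDensity_sq hm hc h0 h1 hf).2
  obtain ⟨hβ, h⟩ := solvesBetaEq_beta hm hc h0 h1 hf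
  refine ⟨integrable_juttner_div_energy hm hc _ hβ _, fun μ =>
    (particleFlux_juttner hm hc _ hβ _ μ).1, ?_, fun μ => ?_⟩
  · rw [localJuttner, scalarMoment_juttner hm hc _ hβ, besselRatio, h]
    field_simp
  · rw [localJuttner, (particleFlux_juttner hm hc _ hβ _ μ).2, ← particleFlux_eq hm hc h0 h1 hf]

theorem contract_fourVelocity_self (u : E3) : contract (fourVelocity u) (fourVelocity u) = 1 := by
  have := lorentzFactor_sq u
  rw [← real_inner_self_eq_norm_sq, inner_eq] at this
  rw [contract_eq]
  change lorentzFactor u * lorentzFactor u - (u 0 * u 0 + u 1 * u 1 + u 2 * u 2) = 1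
  linarith

/-- From `N^μ = n u^μ` and `u_μ u^μ = 1` one gets `N^μ N_μ = n²`, and `n ≥ 0` selects the root; the
velocity and the equation for `β` follow on dividing by `n`. -/
theorem eq_of_sameMoments_juttner (hm : 0 < m) (hc : 0 < c) (hpos : 0 < properDensity m c f)
    {n β : ℝ} {u : E3} (hn : 0 ≤ n) (hβ : 0 < β) (h : SameMoments m c f (juttner m c n β u)) :
    n = properDensity m c f ∧ SolvesBetaEq m c f β ∧ u = velocity m c f := by
  obtain ⟨-, -, hS, hN⟩ := h
  have hN' : ∀ μ, particleFlux m c f μ = n * fourVelocity u μ := fun μ => by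
    rw [← hN, (particleFlux_juttner hm hc n hβ u μ).2]
  have hnf : properDensity m c f = n := by
    rw [properDensity]
    have : contract (particleFlux m c f) (particleFlux m c f)
        = n ^ 2 * contract (fourVelocity u) (fourVelocity u) := by
      rw [contract_eq, contract_eq]; simp only [hN']; ring
    rw [this, contract_fourVelocity_self, mul_one, Real.sqrt_sq hn]
  rw [hnf] at hpos
  refine ⟨hnf.symm, ⟨hβ, ?_⟩, ?_⟩
  · rw [← hS, scalarMoment_juttner hm hc n hβ, hnf, besselRatio]
    field_simp
  · ext i
    simp only [velocity, hN', hnf]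
    change _ = n * u i / n
    field_simp

theorem existsUnique_juttner (hm : 0 < m) (hc : 0 < c) (h0 : ∀ᵐ q, 0 ≤ f q)
    (h1 : ¬ ∀ᵐ q, f q = 0) (hf : HasMoments m c f) :
    ∃! p : ℝ × ℝ × E3, 0 ≤ p.1 ∧ 0 < p.2.1 ∧
      SameMoments m c f (juttner m c p.1 p.2.1 p.2.2) := by
  have hn := (properDensity_sq hm hc h0 h1 hf).2
  have hb := solvesBetaEq_beta hm hc h0 h1 hf
  refine ⟨(properDensity m c f, beta m c f, velocity m c f), ⟨hn.le, hb.1,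
    sameMoments_localJuttner_of_ne_zero hm hc h0 h1 hf⟩, ?_⟩
  rintro ⟨n, β, u⟩ ⟨hn', hβ, h⟩
  obtain ⟨h2, h3, h4⟩ := eq_of_sameMoments_juttner hm hc hn hn' hβ h
  exact Prod.ext h2 (Prod.ext ((existsUnique_solvesBetaEq hm hc h0 h1 hf).unique h3 hb) h4)

theorem particleFlux_eq_zero (h : ∀ᵐ q, f q = 0) (μ : Fin 4) : particleFlux m c f μ = 0 :=
  integral_eq_zero_of_ae (by filter_upwards [h] with q hq; simp [hq])

theorem localJuttner_eq_zero (h : ∀ᵐ q, f q = 0) : localJuttner m c f = 0 := by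
  ext q
  have : properDensity m c f = 0 := by
    simp [properDensity, contract_eq, particleFlux_eq_zero h]
  simp [localJuttner, juttner, this]

theorem sameMoments_localJuttner (hm : 0 < m) (hc : 0 < c) (h0 : ∀ᵐ q, 0 ≤ f q)
    (hf : HasMoments m c f) : SameMoments m c f (localJuttner m c f) := by
  by_cases h1 : ∀ᵐ q, f q = 0
  · rw [localJuttner_eq_zero h1]
    refine ⟨by simp, by simp, ?_, fun μ => ?_⟩
    · rw [scalarMoment, scalarMoment]
      refine integral_congr_ae ?_
      filter_upwards [h1] with q hq; simp [hq]
    · rw [particleFlux_eq_zero h1, particleFlux_eq_zero (f := 0) (Eventually.of_forall fun _ => rfl)]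
  · exact sameMoments_localJuttner_of_ne_zero hm hc h0 h1 hf

theorem localJuttner_nonneg (hm : 0 < m) (hc : 0 < c) (h0 : ∀ᵐ q, 0 ≤ f q)
    (hf : HasMoments m c f) (q : E3) : 0 ≤ localJuttner m c f q := by
  by_cases h1 : ∀ᵐ q, f q = 0
  · rw [localJuttner_eq_zero h1]; rfl
  · have hn := (properDensity_sq hm hc h0 h1 hf).2
    have := juttnerMass_pos (solvesBetaEq_beta hm hc h0 h1 hf).1
    rw [localJuttner, juttner]
    positivity

end Moments

/-! ### Measurability of the local equilibrium -/

/-- The inverse of the ratio `K₁ / K₂`. -/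
noncomputable def besselRatioInv (s : ℝ) : ℝ :=
  Classical.epsilon fun β => 0 < β ∧ besselRatio β = s

/-- Only one number attached to `f` enters `beta`, so its measurability in `(t, x)` reduces to that
of the moments and of one real function. -/
theorem beta_eq (m c : ℝ) (f : E3 → ℝ) :
    beta m c f = besselRatioInv (m * c ^ 2 / properDensity m c f * scalarMoment m c f) := rfl

theorem besselRatioInv_spec {s : ℝ} (hs : s ∈ Ioo (0 : ℝ) 1) :
    0 < besselRatioInv s ∧ besselRatio (besselRatioInv s) = s :=
  Classical.epsilon_spec (exists_besselRatio_eq hs.1 hs.2)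

/-- Outside `(0, 1)` the predicate is everywhere false, so the default choice is the same number for
all such `s`. -/
theorem besselRatioInv_of_notMem {s : ℝ} (hs : s ∉ Ioo (0 : ℝ) 1) :
    besselRatioInv s = Classical.epsilon fun _ : ℝ => False := by
  unfold besselRatioInv
  congr 1; ext β
  simp only [iff_false]
  rintro ⟨hβ, rfl⟩
  exact hs ⟨besselRatio_pos hβ, besselRatio_lt_one hβ⟩

theorem monotoneOn_besselRatioInv : MonotoneOn besselRatioInv (Ioo 0 1) := by
  intro s hs t ht h
  obtain ⟨hs1, hs2⟩ := besselRatioInv_spec hs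
  obtain ⟨ht1, ht2⟩ := besselRatioInv_spec ht
  rw [← hs2, ← ht2] at h
  exact (besselRatio_strictMonoOn.le_iff_le hs1 ht1).1 h

/-- Superlevel sets are order-convex within `(0, 1)` by monotonicity; on the complement the function
is constant. -/
theorem measurable_besselRatioInv : Measurable besselRatioInv := by
  refine measurable_of_Ioi fun b => ?_
  have h : besselRatioInv ⁻¹' Ioi b = (Ioo 0 1 ∩ besselRatioInv ⁻¹' Ioi b) ∪
      ((Ioo 0 1)ᶜ ∩ {_s | b < Classical.epsilon fun _ : ℝ => False}) := by
    ext s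
    by_cases hs : s ∈ Ioo (0 : ℝ) 1
    · simp [hs]
    · simp only [mem_union, mem_inter_iff, hs, false_and, false_or, mem_compl_iff,
        not_false_eq_true, true_and, mem_preimage, besselRatioInv_of_notMem hs, mem_ofPred_eq,
        mem_Ioi]
  rw [h]
  refine MeasurableSet.union (OrdConnected.measurableSet ⟨?_⟩)
    (measurableSet_Ioo.compl.inter (MeasurableSet.const _))
  rintro s ⟨hs, hsb⟩ t ⟨ht, -⟩ r ⟨h1, h2⟩
  have hr : r ∈ Ioo (0 : ℝ) 1 := ⟨hs.1.trans_le h1, h2.trans_lt ht.2⟩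
  exact ⟨hr, lt_of_lt_of_le hsb (monotoneOn_besselRatioInv hs hr h1)⟩

theorem measurable_juttnerMass : Measurable juttnerMass := by
  have : Continuous (Function.uncurry fun (β : ℝ) (p : E3) =>
      Real.exp (-β * √(1 + ‖p‖ ^ 2))) := by
    unfold Function.uncurry; fun_prop
  exact (this.stronglyMeasurable.integral_prod_right (ν := volume)).measurable

theorem measurable_juttner (m c : ℝ) :
    Measurable fun a : (ℝ × ℝ × E3) × E3 => juttner m c a.1.1 a.1.2.1 a.1.2.2 a.2 := by
  simp only [juttner, contract_fourVelocity_fourMomentum]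
  have h1 := measurable_juttnerMass
  have h2 := continuous_lorentzFactor.measurable
  have h3 := (continuous_energy m c).measurable
  have h4 : Measurable fun a : (ℝ × ℝ × E3) × E3 => inner ℝ a.1.2.2 a.2 := by fun_prop
  fun_prop

section

variable {m c : ℝ} {K : Set Spacetime} {f : Spacetime → E3 → ℝ}

theorem aestronglyMeasurable_weight
    (hf : AEStronglyMeasurable (fun z : Spacetime × E3 => f z.1 z.2)
      ((volume.restrict K).prod volume)) {F : E3 → ℝ} (hF : Continuous F) :
    AEStronglyMeasurable (fun z : Spacetime × E3 => F z.2 * f z.1 z.2 / energy m c z.2)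
      ((volume.restrict K).prod volume) :=
  ((hF.comp continuous_snd).aestronglyMeasurable.mul hf).div₀
    ((continuous_energy m c).comp continuous_snd).aestronglyMeasurable

theorem continuous_fourMomentum (m c : ℝ) (μ : Fin 4) :
    Continuous fun q => fourMomentum m c q μ := by
  refine Fin.cases (continuous_energy m c) (fun i => ?_) μ
  simp only [fourMomentum_succ]; fun_prop

theorem aemeasurable_particleFlux
    (hf : AEStronglyMeasurable (fun z : Spacetime × E3 => f z.1 z.2)
      ((volume.restrict K).prod volume)) (μ : Fin 4) :
    AEMeasurable (fun X => particleFlux m c (f X) μ) (volume.restrict K) :=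
  (aestronglyMeasurable_weight hf
    (continuous_fourMomentum m c μ)).integral_prod_right'.aemeasurable

theorem aemeasurable_scalarMoment
    (hf : AEStronglyMeasurable (fun z : Spacetime × E3 => f z.1 z.2)
      ((volume.restrict K).prod volume)) :
    AEMeasurable (fun X => scalarMoment m c (f X)) (volume.restrict K) := by
  have := (aestronglyMeasurable_weight (m := m) (c := c) hf
    (continuous_const (y := (1 : ℝ)))).integral_prod_right'.aemeasurable
  simpa only [one_mul, scalarMoment] using this

theorem aestronglyMeasurable_localJuttner
    (hf : AEStronglyMeasurable (fun z : Spacetime × E3 => f z.1 z.2)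
      ((volume.restrict K).prod volume)) :
    AEStronglyMeasurable (fun z : Spacetime × E3 => localJuttner m c (f z.1) z.2)
      ((volume.restrict K).prod volume) := by
  have hN := fun μ => aemeasurable_particleFlux (m := m) (c := c) hf μ
  have hn : AEMeasurable (fun X => properDensity m c (f X)) (volume.restrict K) := by
    simp only [properDensity, contract_eq]
    have h0 := hN 0
    have h1 := hN 1
    have h2 := hN 2
    have h3 := hN 3
    exact Real.continuous_sqrt.measurable.comp_aemeasurable
      ((h0.mul h0).sub (((h1.mul h1).add (h2.mul h2)).add (h3.mul h3)))
  have hβ : AEMeasurable (fun X => beta m c (f X)) (volume.restrict K) := by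
    simp only [beta_eq]
    exact measurable_besselRatioInv.comp_aemeasurable
      ((aemeasurable_const.div hn).mul (aemeasurable_scalarMoment hf))
  have hu : AEMeasurable (fun X => velocity m c (f X)) (volume.restrict K) :=
    (WithLp.measurable_toLp 2 _).comp_aemeasurable
      (aemeasurable_pi_lambda _ fun i => (hN i.succ).div hn)
  exact ((measurable_juttner m c).comp_aemeasurable
    (((hn.prodMk (hβ.prodMk hu)).comp_fst).prodMk measurable_snd.aemeasurable)).aestronglyMeasurable

/-! ### Integrability over `K × ℝ³` -/

theorem integrable_weight_of_le (hm : 0 < m) (hc : 0 < c)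
    (hf : AEStronglyMeasurable (fun z : Spacetime × E3 => f z.1 z.2)
      ((volume.restrict K).prod volume)) {F G : E3 → ℝ} (hF : Continuous F)
    (hle : ∀ q, |F q| ≤ G q)
    (hG : Integrable (fun z : Spacetime × E3 => G z.2 * f z.1 z.2 / energy m c z.2)
      ((volume.restrict K).prod volume)) :
    Integrable (fun z : Spacetime × E3 => F z.2 * f z.1 z.2 / energy m c z.2)
      ((volume.restrict K).prod volume) := by
  refine hG.mono (aestronglyMeasurable_weight hf hF) (Eventually.of_forall fun z => ?_)
  have hp := energy_pos hm hc z.2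
  rw [norm_div, norm_div, norm_mul, norm_mul]
  gcongr
  exact (hle z.2).trans (le_abs_self _)

/-- Tonelli: the integrand is nonnegative, so the section integrals of its norm are the moments
themselves. -/
theorem integrable_weight_of_sections (hm : 0 < m) (hc : 0 < c)
    (hf : AEStronglyMeasurable (fun z : Spacetime × E3 => f z.1 z.2)
      ((volume.restrict K).prod volume)) {G : E3 → ℝ} (hG : Continuous G) (h0 : ∀ q, 0 ≤ G q)
    (hnn : ∀ᵐ X ∂(volume.restrict K), ∀ᵐ q, 0 ≤ f X q)
    (hs : ∀ᵐ X ∂(volume.restrict K), Integrable fun q => G q * f X q / energy m c q)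
    (hi : IntegrableOn (fun X => ∫ q, G q * f X q / energy m c q) K) :
    Integrable (fun z : Spacetime × E3 => G z.2 * f z.1 z.2 / energy m c z.2)
      ((volume.restrict K).prod volume) := by
  refine (integrable_prod_iff (aestronglyMeasurable_weight hf hG)).2 ⟨hs, hi.congr ?_⟩
  filter_upwards [hnn] with X hX
  refine integral_congr_ae ?_
  filter_upwards [hX] with q hq
  have := energy_pos hm hc q
  have := h0 q
  rw [Real.norm_of_nonneg (by positivity)]

theorem abs_fourMomentum_le (hm : 0 < m) (hc : 0 < c) (μ : Fin 4) (q : E3) :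
    |fourMomentum m c q μ| ≤ energy m c q := by
  refine Fin.cases ?_ (fun i => ?_) μ
  · exact (abs_of_pos (energy_pos hm hc q)).le
  · rw [fourMomentum_succ, abs_mul, abs_of_pos hc]
    exact (mul_le_mul_of_nonneg_left (abs_apply_le_norm q i) hc.le).trans
      (mul_norm_lt_energy hm hc q).le

/-- The weights `1` and `q^ν`, whose integrals are conserved by collisions. -/
structure IsCollisionInvariant (m c : ℝ) (F : E3 → ℝ) : Prop where
  contDiff : ContDiff ℝ ((⊤ : ℕ∞) : WithTop ℕ∞) F
  abs_le : ∃ C, 0 ≤ C ∧ ∀ q, |F q| ≤ C * energy m c q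
  balance : ∀ g : E3 → ℝ, (∀ᵐ q, 0 ≤ g q) → HasMoments m c g →
    ∫ q, F q * localJuttner m c g q / energy m c q = ∫ q, F q * g q / energy m c q

theorem isCollisionInvariant_one (hm : 0 < m) (hc : 0 < c) :
    IsCollisionInvariant m c fun _ => 1 := by
  have hmc : 0 < m * c ^ 2 := by positivity
  refine ⟨contDiff_const, ⟨(m * c ^ 2)⁻¹, by positivity, fun q => ?_⟩, fun g h0 hg => ?_⟩
  · rw [abs_one, inv_mul_eq_div, one_le_div hmc]
    exact le_energy hc q
  · simpa only [one_mul, scalarMoment] using (sameMoments_localJuttner hm hc h0 hg).2.2.1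

theorem contDiff_energy (hm : 0 < m) (hc : 0 < c) :
    ContDiff ℝ ((⊤ : ℕ∞) : WithTop ℕ∞) (energy m c) := by
  have : ContDiff ℝ ((⊤ : ℕ∞) : WithTop ℕ∞) fun q : E3 => (m * c) ^ 2 + ‖q‖ ^ 2 :=
    contDiff_const.add (contDiff_norm_sq ℝ)
  exact contDiff_const.mul (this.sqrt fun q => by positivity)

theorem isCollisionInvariant_fourMomentum (hm : 0 < m) (hc : 0 < c) (ν : Fin 4) :
    IsCollisionInvariant m c fun q => fourMomentum m c q ν := by
  refine ⟨?_, ⟨1, zero_le_one, fun q => ?_⟩, fun g h0 hg => ?_⟩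
  · refine Fin.cases (contDiff_energy hm hc) (fun i => ?_) ν
    simp only [fourMomentum_succ]
    fun_prop
  · rw [one_mul]; exact abs_fourMomentum_le hm hc ν q
  · exact (sameMoments_localJuttner hm hc h0 hg).2.2.2 ν

theorem restrict_prod_univ (K : Set Spacetime) :
    (volume : Measure (Spacetime × E3)).restrict (K ×ˢ univ)
      = (volume.restrict K).prod volume := by
  rw [Measure.volume_eq_prod, ← Measure.prod_restrict, Measure.restrict_univ]

/-! ### Moments and local equilibria of weak phase densities over compact sets. -/

section WeakPhaseDensity

variable {U : Set Spacetime}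

theorem IsWeakPhaseDensity.integrable (hm : 0 < m) (hc : 0 < c) (hf : IsWeakPhaseDensity m c U f)
    (hK : IsCompact K) (hKU : K ⊆ U) :
    Integrable (fun z : Spacetime × E3 => f z.1 z.2) ((volume.restrict K).prod volume) := by
  have := hf.integrable_flux K hK hKU 0
  rw [IntegrableOn, restrict_prod_univ] at this
  refine this.congr (Eventually.of_forall fun z => ?_)
  have := energy_pos hm hc z.2
  simp only [fourMomentum_zero]
  field_simp

theorem IsWeakPhaseDensity.ae_hasMoments (hf : IsWeakPhaseDensity m c U f)
    (hK : IsCompact K) (hKU : K ⊆ U) :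
    ∀ᵐ X ∂(volume.restrict K), (∀ᵐ q, 0 ≤ f X q) ∧ HasMoments m c (f X) := by
  have h0 : ∀ᵐ z : Spacetime × E3 ∂((volume.restrict K).prod volume), 0 ≤ f z.1 z.2 := by
    rw [← restrict_prod_univ]
    exact ae_restrict_of_ae_restrict_of_subset (prod_mono hKU le_rfl) hf.nonneg
  have h1 : ∀ᵐ X ∂(volume.restrict K), ∀ μ,
      Integrable (fun q => fourMomentum m c q μ * f X q / energy m c q) :=
    ae_all_iff.2 fun μ => by
      have := hf.integrable_flux K hK hKU μ
      rw [IntegrableOn, restrict_prod_univ] at this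
      exact this.prod_right_ae
  have h2 : ∀ᵐ X ∂(volume.restrict K), ∀ μ ν, Integrable
      (fun q => fourMomentum m c q μ * fourMomentum m c q ν * f X q / energy m c q) :=
    ae_all_iff.2 fun μ => ae_all_iff.2 fun ν => by
      have := hf.integrable_tensor K hK hKU μ ν
      rw [IntegrableOn, restrict_prod_univ] at this
      exact this.prod_right_ae
  filter_upwards [Measure.ae_ae_of_ae_prod h0, h1, h2] with X a b d using ⟨a, b, d⟩

theorem IsWeakPhaseDensity.integrable_weight (hm : 0 < m) (hc : 0 < c)
    (hf : IsWeakPhaseDensity m c U f) (hK : IsCompact K) (hKU : K ⊆ U) {F : E3 → ℝ}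
    (hF : Continuous F) {C : ℝ} (hle : ∀ q, |F q| ≤ C * (energy m c q * energy m c q)) :
    Integrable (fun z : Spacetime × E3 => F z.2 * f z.1 z.2 / energy m c z.2)
      ((volume.restrict K).prod volume) := by
  have h := hf.integrable_tensor K hK hKU 0 0
  rw [IntegrableOn, restrict_prod_univ] at h
  refine integrable_weight_of_le hm hc
    (hf.integrable hm hc hK hKU).aestronglyMeasurable hF hle ?_
  refine (h.const_mul C).congr (Eventually.of_forall fun z => ?_)
  simp only [fourMomentum_zero]
  ring

/-- Joint control of `J_f` comes from the matched moments: it is nonnegative and its `N^0` is that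
of `f`. Second moments are not matched, hence the weight grows at most like `q^0`, whereas `(q^0)²`
is allowed against `f`. -/
theorem IsWeakPhaseDensity.integrable_localJuttner (hm : 0 < m) (hc : 0 < c)
    (hf : IsWeakPhaseDensity m c U f) (hK : IsCompact K) (hKU : K ⊆ U) {F : E3 → ℝ}
    (hF : Continuous F) {C : ℝ} (hle : ∀ q, |F q| ≤ C * energy m c q) :
    Integrable (fun z : Spacetime × E3 =>
      F z.2 * localJuttner m c (f z.1) z.2 / energy m c z.2)
      ((volume.restrict K).prod volume) := by
  have hmeas := aestronglyMeasurable_localJuttner (m := m) (c := c)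
    (hf.integrable hm hc hK hKU).aestronglyMeasurable
  have hae := hf.ae_hasMoments hK hKU
  have h1 : Integrable (fun z : Spacetime × E3 =>
      energy m c z.2 * localJuttner m c (f z.1) z.2 / energy m c z.2)
      ((volume.restrict K).prod volume) := by
    refine integrable_weight_of_sections (f := fun X => localJuttner m c (f X)) hm hc hmeas
      (continuous_energy m c) (fun q => (energy_pos hm hc q).le) ?_ ?_ ?_
    · filter_upwards [hae] with X hX
      exact Eventually.of_forall (localJuttner_nonneg hm hc hX.1 hX.2)
    · filter_upwards [hae] with X hX
      exact (sameMoments_localJuttner hm hc hX.1 hX.2).2.1 0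
    · have h := hf.integrable_flux K hK hKU 0
      rw [IntegrableOn, restrict_prod_univ] at h
      refine h.integral_prod_left.congr ?_
      filter_upwards [hae] with X hX
      exact ((sameMoments_localJuttner hm hc hX.1 hX.2).2.2.2 0).symm
  refine integrable_weight_of_le (f := fun X => localJuttner m c (f X)) hm hc hmeas hF hle ?_
  refine (h1.const_mul C).congr (Eventually.of_forall fun z => ?_)
  simp only
  ring

end WeakPhaseDensity

end

/-! ### Distributional solutions -/

section

variable {m c : ℝ}

theorem transport_eq (hm : 0 < m) (hc : 0 < c) (q : E3) (φ : Spacetime → ℝ) (X : Spacetime) :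
    transport m c q φ X
      = ∑ μ, c * (fourMomentum m c q μ / energy m c q * partialST c μ φ X) := by
  have hq := energy_pos hm hc q
  rw [Fin.sum_univ_succ]
  simp only [fourMomentum_zero, fourMomentum_succ, partialST, Fin.cons_zero, Fin.cons_succ,
    div_self hq.ne', transport]
  congr 1
  · field_simp
  · rw [Finset.mul_sum]
    refine Finset.sum_congr rfl fun i _ => ?_
    rw [energy] at *
    field_simp

/-- The direction of `∂ / ∂x^μ`. -/
noncomputable def coordDir (c : ℝ) (μ : Fin 4) : Spacetime :=
  Fin.cases ((1 / c, 0) : Spacetime) (fun i : Fin 3 => (0, EuclideanSpace.single i 1)) μ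

theorem partialST_eq (c : ℝ) (μ : Fin 4) (φ : Spacetime → ℝ) (X : Spacetime) :
    partialST c μ φ X = fderiv ℝ φ X (coordDir c μ) := by
  refine Fin.cases ?_ (fun i => rfl) μ
  change 1 / c * fderiv ℝ φ X (1, 0) = fderiv ℝ φ X (1 / c, 0)
  rw [← smul_eq_mul, ← map_smul]
  simp

theorem continuous_partialST {φ : Spacetime → ℝ} (hφ : ContDiff ℝ 1 φ) (μ : Fin 4) :
    Continuous (partialST c μ φ) := by
  rw [show partialST c μ φ = fun X => fderiv ℝ φ X (coordDir c μ) from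
    funext fun X => partialST_eq c μ φ X]
  exact (hφ.continuous_fderiv one_ne_zero).clm_apply continuous_const

theorem partialST_of_notMem_tsupport {φ : Spacetime → ℝ} {X : Spacetime} (hX : X ∉ tsupport φ)
    (μ : Fin 4) : partialST c μ φ X = 0 := by
  rw [partialST_eq, fderiv_of_notMem_tsupport ℝ hX]; rfl

theorem transport_mul_const {φ : Spacetime → ℝ} (hφ : Differentiable ℝ φ) (q : E3) (a : ℝ)
    (X : Spacetime) : transport m c q (fun Y => φ Y * a) X = transport m c q φ X * a := by
  simp only [transport, partialT, partialX, fderiv_mul_const (hφ X), smul_apply, smul_eq_mul,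
    Finset.mul_sum, add_mul, Finset.sum_mul]
  congr 1
  · ring
  · exact Finset.sum_congr rfl fun i _ => by ring

variable {K : Set Spacetime}

theorem integrable_mul_of_support {φ W : Spacetime × E3 → ℝ}
    (hφ : Continuous φ) {C : ℝ} (hC : ∀ z, |φ z| ≤ C) (h0 : ∀ z, z.1 ∉ K → φ z = 0)
    (hW : Integrable W ((volume.restrict K).prod volume)) :
    Integrable (fun z => φ z * W z) := by
  have h1 : Integrable (fun z => φ z * W z) ((volume.restrict K).prod volume) :=
    hW.bdd_mul hφ.aestronglyMeasurable (Eventually.of_forall hC)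
  rw [← restrict_prod_univ] at h1
  refine (integrableOn_iff_integrable_of_support_subset fun z hz => ?_).1 h1
  refine ⟨by_contra fun h => hz ?_, mem_univ _⟩
  simp [h0 z h]

theorem integrable_fst_mul (hK : IsCompact K) {h : Spacetime → ℝ} {W : Spacetime × E3 → ℝ}
    (hh : Continuous h) (h0 : ∀ X, X ∉ K → h X = 0)
    (hW : Integrable W ((volume.restrict K).prod volume)) :
    Integrable (fun z => h z.1 * W z) ∧ Integrable (fun X => h X * ∫ q, W (X, q)) ∧
    ∫ z, h z.1 * W z = ∫ X, h X * ∫ q, W (X, q) := by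
  obtain ⟨C, hC⟩ := hK.exists_bound_of_continuousOn hh.continuousOn
  have h1 : Integrable (fun z : Spacetime × E3 => h z.1 * W z) := by
    refine integrable_mul_of_support (hh.comp continuous_fst) (C := |C|) (fun z => ?_)
      (fun z hz => h0 _ hz) hW
    by_cases hz : z.1 ∈ K
    · exact (hC _ hz).trans (le_abs_self C)
    · simp [h0 _ hz]
  refine ⟨h1, ?_, ?_⟩
  · rw [Measure.volume_eq_prod] at h1
    simpa only [integral_const_mul] using h1.integral_prod_left
  · rw [Measure.volume_eq_prod] at h1 ⊢
    rw [integral_prod _ h1]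
    simp only [integral_const_mul]

variable {ω : ℝ} {U : Set Spacetime} {f : Spacetime → E3 → ℝ}

/-- The pairing with a test function `ψ F` where `F` need not have compact support. -/
theorem IsWeakSolution.integral_eq_zero_of_weight
    (hsol : IsWeakSolution m c ω U f)
    {F : E3 → ℝ} (hF : ContDiff ℝ ((⊤ : ℕ∞) : WithTop ℕ∞) F) {ψ : Spacetime → ℝ}
    (hψ : ContDiff ℝ ((⊤ : ℕ∞) : WithTop ℕ∞) ψ) (hcs : HasCompactSupport ψ) (hU : tsupport ψ ⊆ U)
    (hG : Integrable (fun z : Spacetime × E3 => f z.1 z.2 * (transport m c z.2 ψ z.1 * F z.2) +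
      relaxation m c ω (f z.1) z.2 * (ψ z.1 * F z.2))) :
    ∫ z : Spacetime × E3, (f z.1 z.2 * (transport m c z.2 ψ z.1 * F z.2) +
      relaxation m c ω (f z.1) z.2 * (ψ z.1 * F z.2)) = 0 := by
  set G := fun z : Spacetime × E3 => f z.1 z.2 * (transport m c z.2 ψ z.1 * F z.2) +
      relaxation m c ω (f z.1) z.2 * (ψ z.1 * F z.2) with hGdef
  -- Cutoffs in momentum only. Transport differentiates in `(t, x)`, so no derivative of the cutoff
  -- appears and `|G|` dominates.
  let χ : ℕ → ContDiffBump (0 : E3) := fun k => ⟨k + 1, k + 2, by positivity, by linarith⟩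
  have hψd : Differentiable ℝ ψ := hψ.differentiable (by simp)
  have hzero : ∀ k, ∫ z : Spacetime × E3, χ k z.2 * G z = 0 := by
    intro k
    have hχ : ContDiff ℝ ((⊤ : ℕ∞) : WithTop ℕ∞) (χ k : E3 → ℝ) := (χ k).contDiff
    have hsub : Function.support (fun z : Spacetime × E3 => ψ z.1 * (F z.2 * χ k z.2))
        ⊆ tsupport ψ ×ˢ tsupport (χ k : E3 → ℝ) := by
      intro z hz
      have h := mul_ne_zero_iff.1 hz
      exact ⟨subset_tsupport _ h.1, subset_tsupport _ (mul_ne_zero_iff.1 h.2).2⟩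
    have hcomp : IsCompact (tsupport ψ ×ˢ tsupport (χ k : E3 → ℝ)) :=
      IsCompact.prod hcs (χ k).hasCompactSupport
    have hts := closure_minimal hsub hcomp.isClosed
    have := hsol (fun z => ψ z.1 * (F z.2 * χ k z.2))
      ((hψ.comp contDiff_fst).mul ((hF.comp contDiff_snd).mul (hχ.comp contDiff_snd)))
      (hcomp.of_isClosed_subset (isClosed_tsupport _) hts)
      (hts.trans (prod_mono hU (subset_univ _)))
    rw [← this]
    congr 1; ext z
    simp only [transport_mul_const hψd, hGdef]
    ring
  have hlim : Tendsto (fun k => ∫ z : Spacetime × E3, χ k z.2 * G z) atTop (𝓝 (∫ z, G z)) := by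
    refine tendsto_integral_of_dominated_convergence (fun z => ‖G z‖) (fun k => ?_) hG.norm
      (fun k => ?_) ?_
    · exact ((χ k).continuous.comp continuous_snd).aestronglyMeasurable.mul hG.aestronglyMeasurable
    · refine Eventually.of_forall fun z => ?_
      rw [norm_mul, Real.norm_of_nonneg (χ k).nonneg]
      exact mul_le_of_le_one_left (norm_nonneg _) (χ k).le_one
    · refine Eventually.of_forall fun z => tendsto_const_nhds.congr' ?_
      filter_upwards [eventually_ge_atTop ⌈‖z.2‖⌉₊] with k hk
      have : z.2 ∈ Metric.closedBall (0 : E3) (χ k).rIn := by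
        rw [mem_closedBall_zero_iff]
        have := (Nat.le_ceil ‖z.2‖).trans (Nat.cast_le.2 hk)
        change ‖z.2‖ ≤ (k : ℝ) + 1
        linarith
      rw [(χ k).one_of_mem_closedBall this, one_mul]
  simp only [hzero] at hlim
  exact tendsto_nhds_unique hlim tendsto_const_nhds

/-- The equation is tested with `ψ F`. Fubini turns the transport part into `c` times the asserted
pairing, and the collision part vanishes on integrating in `q` first. -/
theorem IsWeakPhaseDensity.weakDivFree_weight (hm : 0 < m) (hc : 0 < c)
    (hf : IsWeakPhaseDensity m c U f) (hsol : IsWeakSolution m c ω U f) {F : E3 → ℝ}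
    (hF : IsCollisionInvariant m c F) {ψ : Spacetime → ℝ}
    (hψ : ContDiff ℝ ((⊤ : ℕ∞) : WithTop ℕ∞) ψ) (hcs : HasCompactSupport ψ)
    (hU : tsupport ψ ⊆ U) :
    ∫ X, ∑ μ, (∫ q, fourMomentum m c q μ * F q * f X q / energy m c q)
      * partialST c μ ψ X = 0 := by
  obtain ⟨C, hC, hle⟩ := hF.abs_le
  have hFc := hF.contDiff.continuous
  have hψ1 : ContDiff ℝ 1 ψ := hψ.of_le (by exact_mod_cast le_top)
  have hW : ∀ μ, Integrable
      (fun z : Spacetime × E3 => fourMomentum m c z.2 μ * F z.2 * f z.1 z.2 / energy m c z.2)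
      ((volume.restrict (tsupport ψ)).prod volume) := fun μ =>
    hf.integrable_weight hm hc hcs hU (F := fun q => fourMomentum m c q μ * F q)
      ((continuous_fourMomentum m c μ).mul hFc) (C := C) fun q => by
        rw [abs_mul]
        calc _ ≤ energy m c q * (C * energy m c q) := mul_le_mul (abs_fourMomentum_le hm hc μ q)
              (hle q) (abs_nonneg _) (energy_pos hm hc q).le
          _ = _ := by ring
  have hWf : Integrable (fun z : Spacetime × E3 => F z.2 * f z.1 z.2 / energy m c z.2)
      ((volume.restrict (tsupport ψ)).prod volume) :=
    hf.integrable_weight hm hc hcs hU hFc (C := C * (m * c ^ 2)⁻¹) fun q => by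
      have hmc : 0 < m * c ^ 2 := by positivity
      have h1 : 1 ≤ (m * c ^ 2)⁻¹ * energy m c q := by
        rw [inv_mul_eq_div, one_le_div hmc]; exact le_energy hc q
      have h2 : 0 ≤ C * energy m c q := mul_nonneg hC (energy_pos hm hc q).le
      calc _ ≤ C * energy m c q := hle q
        _ ≤ C * energy m c q * ((m * c ^ 2)⁻¹ * energy m c q) := le_mul_of_one_le_right h2 h1
        _ = _ := by ring
  have hWJ := hf.integrable_localJuttner hm hc hcs hU hFc hle
  have hd := fun μ => integrable_fst_mul hcs (continuous_partialST (c := c) hψ1 μ)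
    (fun X hX => partialST_of_notMem_tsupport hX μ) (hW μ)
  obtain ⟨hr1, -, hr3⟩ := integrable_fst_mul hcs hψ1.continuous
    (fun X hX => image_eq_zero_of_notMem_tsupport hX) (hWJ.sub hWf)
  have hrel : ∫ X, ψ X * ∫ q, (F q * localJuttner m c (f X) q / energy m c q
      - F q * f X q / energy m c q) = 0 := by
    refine integral_eq_zero_of_ae ?_
    have h1 := (ae_restrict_iff' hcs.isClosed.measurableSet).1 (hf.ae_hasMoments hcs hU)
    have h2 := (ae_restrict_iff' hcs.isClosed.measurableSet).1 hWJ.prod_right_ae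
    have h3 := (ae_restrict_iff' hcs.isClosed.measurableSet).1 hWf.prod_right_ae
    filter_upwards [h1, h2, h3] with X hX hX2 hX3
    by_cases h : X ∈ tsupport ψ
    · rw [integral_sub (hX2 h) (hX3 h), hF.balance _ (hX h).1 (hX h).2, sub_self, mul_zero]
      rfl
    · simp [image_eq_zero_of_notMem_tsupport h]
  have hGeq : (fun z : Spacetime × E3 => f z.1 z.2 * (transport m c z.2 ψ z.1 * F z.2) +
      relaxation m c ω (f z.1) z.2 * (ψ z.1 * F z.2)) = fun z =>
      c * ∑ μ, partialST c μ ψ z.1 * (fourMomentum m c z.2 μ * F z.2 * f z.1 z.2 / energy m c z.2)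
      + m * c ^ 2 * ω * (ψ z.1 * (F z.2 * localJuttner m c (f z.1) z.2 / energy m c z.2
        - F z.2 * f z.1 z.2 / energy m c z.2)) := by
    ext z
    rw [transport_eq hm hc, relaxation, Finset.mul_sum, Finset.sum_mul, Finset.mul_sum]
    congr 1
    · exact Finset.sum_congr rfl fun μ _ => by ring
    · ring
  have hs := integrable_finsetSum Finset.univ fun μ _ => (hd μ).1
  have hG := (hs.const_mul c).add (hr1.const_mul (m * c ^ 2 * ω))
  have hz := hsol.integral_eq_zero_of_weight hF.contDiff hψ hcs hU
    (by rw [hGeq]; exact hG)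
  rw [hGeq] at hz
  have hz2 := (integral_add (hs.const_mul c) (hr1.const_mul (m * c ^ 2 * ω))).symm.trans hz
  rw [integral_const_mul, integral_const_mul, integral_finsetSum _ fun μ _ => (hd μ).1] at hz2
  simp only [Pi.sub_apply] at hr3
  have hr4 := hr3.trans hrel
  simp only [Pi.sub_apply, hr4, mul_zero, add_zero] at hz2
  have hz3 := (mul_eq_zero.1 hz2).resolve_left hc.ne'
  simp only [(hd _).2.2] at hz3
  rw [← integral_finsetSum _ fun μ _ => (hd μ).2.1] at hz3
  rw [← hz3]
  congr 1; ext X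
  exact Finset.sum_congr rfl fun μ _ => mul_comm _ _

theorem IsWeakPhaseDensity.weakDivFree_particleFlux (hm : 0 < m) (hc : 0 < c) (hUo : IsOpen U)
    (hf : IsWeakPhaseDensity m c U f) (hsol : IsWeakSolution m c ω U f) :
    WeakDivFree c U (fun X => particleFlux m c (f X)) := by
  refine ⟨fun μ => ?_, fun ψ hψ hcs hU => ?_⟩
  · refine (locallyIntegrableOn_iff hUo.isLocallyClosed).2 fun K hKU hK => ?_
    have h := hf.integrable_flux K hK hKU μ
    rw [IntegrableOn, restrict_prod_univ] at h
    exact h.integral_prod_left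
  · have := hf.weakDivFree_weight hm hc hsol (isCollisionInvariant_one hm hc) hψ hcs hU
    simpa only [mul_one, particleFlux] using this

theorem IsWeakPhaseDensity.weakDivFree_energyMomentum (hm : 0 < m) (hc : 0 < c) (hUo : IsOpen U)
    (hf : IsWeakPhaseDensity m c U f) (hsol : IsWeakSolution m c ω U f) (ν : Fin 4) :
    WeakDivFree c U (fun X => energyMomentum m c (f X) ν) := by
  refine ⟨fun μ => ?_, fun ψ hψ hcs hU => ?_⟩
  · refine (locallyIntegrableOn_iff hUo.isLocallyClosed).2 fun K hKU hK => ?_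
    have h := hf.integrable_tensor K hK hKU ν μ
    rw [IntegrableOn, restrict_prod_univ] at h
    exact h.integral_prod_left.const_mul _
  · have := hf.weakDivFree_weight hm hc hsol (isCollisionInvariant_fourMomentum hm hc ν) hψ hcs hU
    simp only [energyMomentum, mul_assoc (1 / m)]
    simp only [← Finset.mul_sum]
    rw [integral_const_mul]
    simp only [mul_comm (fourMomentum m c _ ν)]
    rw [this, mul_zero]

end

/-! ### Classical solutions -/

section

variable {m c ω : ℝ} {U : Set Spacetime} {f : Spacetime → E3 → ℝ}

theorem integral_fderiv_eq_zero {h : Spacetime → ℝ} (hh : ContDiff ℝ 1 h)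
    (hcs : HasCompactSupport h) (v : Spacetime) : ∫ X, fderiv ℝ h X v = 0 := by
  have hi : Integrable fun X => fderiv ℝ h X v :=
    ((hh.continuous_fderiv one_ne_zero).clm_apply continuous_const).integrable_of_hasCompactSupport
      (hcs.fderiv_apply ℝ v)
  have hd := hh.differentiable one_ne_zero
  have : (volume : Measure Spacetime).IsAddHaarMeasure :=
    Measure.prod.instIsAddHaarMeasure (volume : Measure ℝ) (volume : Measure E3)
  have := integral_mul_fderiv_eq_neg_fderiv_mul_of_integrable (μ := (volume : Measure Spacetime))
    (f := fun _ => (1 : ℝ)) (g := h) (v := v) (by simp) (by simpa using hi)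
    (by simpa using hh.continuous.integrable_of_hasCompactSupport hcs)
    (fun _ _ => by fun_prop) (fun X _ => hd X)
  simpa using this

/-- Integration by parts against a function supported in an open set. -/
theorem integral_mul_fderiv_add (hUo : IsOpen U) {g ψ : Spacetime → ℝ} (hg : ContDiffOn ℝ 1 g U)
    (hψ : ContDiff ℝ 1 ψ) (hcs : HasCompactSupport ψ) (hU : tsupport ψ ⊆ U) (v : Spacetime) :
    Integrable (fun X => g X * fderiv ℝ ψ X v + fderiv ℝ g X v * ψ X) ∧
    ∫ X, (g X * fderiv ℝ ψ X v + fderiv ℝ g X v * ψ X) = 0 := by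
  -- Although `g` is regular only on `U`, the product vanishes near every point outside `U`, so it
  -- is `C¹` on the whole space.
  have hh : ContDiff ℝ 1 fun X => g X * ψ X := by
    rw [contDiff_iff_contDiffAt]
    intro X
    by_cases hX : X ∈ U
    · exact (hg.contDiffAt (hUo.mem_nhds hX)).mul hψ.contDiffAt
    · have := notMem_tsupport_iff_eventuallyEq.1 fun h => hX (hU h)
      refine (contDiffAt_const (c := (0 : ℝ))).congr_of_eventuallyEq ?_
      filter_upwards [this] with Y hY
      simp [hY]
  have hhcs : HasCompactSupport fun X => g X * ψ X := hcs.mul_left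
  have he : (fun X => g X * fderiv ℝ ψ X v + fderiv ℝ g X v * ψ X)
      = fun X => fderiv ℝ (fun X => g X * ψ X) X v := by
    ext X
    by_cases hX : X ∈ U
    · rw [fderiv_fun_mul ((hg.contDiffAt (hUo.mem_nhds hX)).differentiableAt one_ne_zero)
        (hψ.differentiable one_ne_zero X)]
      simp
      ring
    · have h1 : X ∉ tsupport ψ := fun h => hX (hU h)
      have h2 : X ∉ tsupport fun X => g X * ψ X := fun h =>
        h1 (closure_mono (Function.support_mul_subset_right _ _) h)
      rw [fderiv_of_notMem_tsupport ℝ h1, fderiv_of_notMem_tsupport ℝ h2,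
        image_eq_zero_of_notMem_tsupport h1]
      simp
  rw [he]
  exact ⟨((hh.continuous_fderiv one_ne_zero).clm_apply
    continuous_const).integrable_of_hasCompactSupport (hhcs.fderiv_apply ℝ v),
    integral_fderiv_eq_zero hh hhcs v⟩

/-- A continuously differentiable field which is divergence free in the sense of distributions is
divergence free. -/
theorem WeakDivFree.divFree (hUo : IsOpen U) {V : Spacetime → Fin 4 → ℝ}
    (hV : ∀ μ, ContDiffOn ℝ 1 (fun X => V X μ) U) (h : WeakDivFree c U V) : DivFree c U V := by
  have hcont : ContinuousOn (fun X => ∑ μ, partialST c μ (fun Y => V Y μ) X) U := by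
    refine continuousOn_finsetSum _ fun μ _ => ?_
    exact (((hV μ).continuousOn_fderiv_of_isOpen hUo le_rfl).clm_apply
      continuousOn_const).congr fun X _ => partialST_eq c μ _ X
  have hae := hUo.ae_eq_zero_of_integral_contDiff_smul_eq_zero (μ := volume)
    (hcont.locallyIntegrableOn hUo.measurableSet) fun ψ hψ hcs hU => by
      have hψ1 : ContDiff ℝ 1 ψ := hψ.of_le (by exact_mod_cast le_top)
      have hp := fun μ => integral_mul_fderiv_add hUo (hV μ) hψ1 hcs hU (coordDir c μ)
      have hsum : ∫ X, ∑ μ, (V X μ * fderiv ℝ ψ X (coordDir c μ)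
          + fderiv ℝ (fun Y => V Y μ) X (coordDir c μ) * ψ X) = 0 := by
        rw [integral_finsetSum _ fun μ _ => (hp μ).1]
        exact Finset.sum_eq_zero fun μ _ => (hp μ).2
      have h2 := h.2 ψ hψ hcs hU
      have hi2 : Integrable fun X => ∑ μ, V X μ * partialST c μ ψ X := by
        refine integrable_finsetSum _ fun μ _ => ?_
        have hc' := continuous_partialST (c := c) hψ1 μ
        have hVK : IntegrableOn (fun X => V X μ) (tsupport ψ) :=
          ((hV μ).continuousOn.mono hU).integrableOn_compact hcs
        have := hVK.mul_continuousOn (hc'.continuousOn) hcs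
        refine (integrableOn_iff_integrable_of_support_subset fun X hX => ?_).1 this
        by_contra hX'
        exact hX (by simp [partialST_of_notMem_tsupport hX'])
      have hi := integrable_finsetSum Finset.univ fun μ _ => (hp μ).1
      -- `ψ div V = div (ψ V) - V · ∇ψ`: the first term integrates to zero by parts, the second by
      -- hypothesis.
      have e : (fun X => ψ X • ∑ μ, partialST c μ (fun Y => V Y μ) X) = fun X =>
          (∑ μ, (V X μ * fderiv ℝ ψ X (coordDir c μ)
          + fderiv ℝ (fun Y => V Y μ) X (coordDir c μ) * ψ X))
          - ∑ μ, V X μ * partialST c μ ψ X := by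
        ext X
        rw [← Finset.sum_sub_distrib, smul_eq_mul, Finset.mul_sum]
        refine Finset.sum_congr rfl fun μ _ => ?_
        rw [partialST_eq, partialST_eq]; ring
      rw [e, integral_sub hi hi2, hsum, h2, sub_zero]
  have := Measure.eqOn_open_of_ae_eq (μ := volume) (g := fun _ => (0 : ℝ))
    ((ae_restrict_iff' hUo.measurableSet).2 hae) hUo hcont continuousOn_const
  exact fun X hX => this hX

/-- Continuity of `N^0` and `T^{00}` makes them integrable on compact sets, and their integrands
dominate all the others because `|q^μ| ≤ q^0`. -/
theorem IsClassicalSolution.isWeakPhaseDensity (hm : 0 < m) (hc : 0 < c) (hUo : IsOpen U)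
    (hf : IsClassicalSolution m c ω U f) : IsWeakPhaseDensity m c U f := by
  have key : ∀ K : Set Spacetime, IsCompact K → K ⊆ U →
      AEStronglyMeasurable (fun z : Spacetime × E3 => f z.1 z.2)
        ((volume.restrict K).prod volume) ∧
      Integrable (fun z : Spacetime × E3 => energy m c z.2 * f z.1 z.2 / energy m c z.2)
        ((volume.restrict K).prod volume) ∧
      Integrable (fun z : Spacetime × E3 =>
        energy m c z.2 * energy m c z.2 * f z.1 z.2 / energy m c z.2)
        ((volume.restrict K).prod volume) := by
    intro K hK hKU
    have hmeas : AEStronglyMeasurable (fun z : Spacetime × E3 => f z.1 z.2)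
        ((volume.restrict K).prod volume) := by
      rw [← restrict_prod_univ]
      exact hf.measurable.mono_measure (Measure.restrict_mono_set _ (prod_mono hKU le_rfl))
    have hnn : ∀ᵐ X ∂(volume.restrict K), ∀ᵐ q, 0 ≤ f X q :=
      ae_restrict_of_forall_mem hK.measurableSet fun X hX =>
        Eventually.of_forall (hf.nonneg X (hKU hX))
    refine ⟨hmeas, ?_, ?_⟩
    · refine integrable_weight_of_sections hm hc hmeas (continuous_energy m c)
        (fun q => (energy_pos hm hc q).le) hnn (ae_restrict_of_forall_mem hK.measurableSet
          fun X hX => (hf.hasMoments X (hKU hX)).1 0) ?_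
      exact ((hf.contDiff_flux 0).continuousOn.mono hKU).integrableOn_compact hK
    · refine integrable_weight_of_sections (G := fun q => energy m c q * energy m c q) hm hc hmeas
        ((continuous_energy m c).mul (continuous_energy m c))
        (fun q => (mul_pos (energy_pos hm hc q) (energy_pos hm hc q)).le) hnn
        (ae_restrict_of_forall_mem hK.measurableSet
          fun X hX => (hf.hasMoments X (hKU hX)).2 0 0) ?_
      have h := (((hf.contDiff_tensor 0 0).continuousOn.mono hKU).integrableOn_compact
        (μ := volume) hK).const_mul m
      refine h.congr (Eventually.of_forall fun X => ?_)
      simp only [energyMomentum, fourMomentum_zero]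
      field_simp
  refine ⟨?_, fun K hK hKU μ => ?_, fun K hK hKU μ ν => ?_⟩
  · exact ae_restrict_of_forall_mem (hUo.measurableSet.prod MeasurableSet.univ)
      fun z hz => hf.nonneg _ hz.1 _
  · obtain ⟨h0, h1, -⟩ := key K hK hKU
    rw [IntegrableOn, restrict_prod_univ]
    exact integrable_weight_of_le hm hc h0 (continuous_fourMomentum m c μ)
      (abs_fourMomentum_le hm hc μ) h1
  · obtain ⟨h0, -, h2⟩ := key K hK hKU
    rw [IntegrableOn, restrict_prod_univ]
    refine integrable_weight_of_le (F := fun q => fourMomentum m c q μ * fourMomentum m c q ν)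
      (G := fun q => energy m c q * energy m c q) hm hc h0 ((continuous_fourMomentum m c μ).mul (continuous_fourMomentum m c ν))
      (fun q => ?_) h2
    rw [abs_mul]
    exact mul_le_mul (abs_fourMomentum_le hm hc μ q) (abs_fourMomentum_le hm hc ν q)
      (abs_nonneg _) (energy_pos hm hc q).le

theorem transport_eq_fderiv (hm : 0 < m) (hc : 0 < c) (q : E3) (φ : Spacetime → ℝ)
    (X : Spacetime) : transport m c q φ X = fderiv ℝ φ X
      (∑ μ, (c * (fourMomentum m c q μ / energy m c q)) • coordDir c μ) := by
  rw [transport_eq hm hc, map_sum]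
  refine Finset.sum_congr rfl fun μ _ => ?_
  rw [map_smul, smul_eq_mul, partialST_eq]; ring

theorem tsupport_section_subset (φ : Spacetime × E3 → ℝ) (q : E3) :
    tsupport (fun X => φ (X, q)) ⊆ (fun X => (X, q)) ⁻¹' tsupport φ :=
  closure_minimal (fun _ hX => subset_tsupport φ hX)
    ((isClosed_tsupport φ).preimage (by fun_prop))

theorem partialST_section {φ : Spacetime × E3 → ℝ} (hφ : Differentiable ℝ φ) (μ : Fin 4)
    (z : Spacetime × E3) : partialST c μ (fun X => φ (X, z.2)) z.1
      = fderiv ℝ φ z (coordDir c μ, 0) := by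
  rw [partialST_eq]
  have h := HasFDerivAt.comp (g := φ) (f := fun X => (X, z.2)) z.1 (hφ (z.1, z.2)).hasFDerivAt
    (hasFDerivAt_prodMk_left z.1 z.2)
  have h' : fderiv ℝ (fun X => φ (X, z.2)) z.1 = _ := h.fderiv
  rw [h']
  simp

theorem IsClassicalSolution.isWeakSolution (hm : 0 < m) (hc : 0 < c) (hUo : IsOpen U)
    (hf : IsClassicalSolution m c ω U f) : IsWeakSolution m c ω U f := by
  intro φ hφ hcs hU
  have hw := hf.isWeakPhaseDensity hm hc hUo
  set K := Prod.fst '' tsupport φ with hKdef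
  have hK : IsCompact K := hcs.isCompact.image continuous_fst
  have hKU : K ⊆ U := by
    rintro _ ⟨z, hz, rfl⟩; exact (hU hz).1
  have hnot : ∀ z : Spacetime × E3, z.1 ∉ K → z ∉ tsupport φ := fun z hz h => hz ⟨z, h, rfl⟩
  have hφd : Differentiable ℝ φ := hφ.differentiable (by simp)
  have hφf : Continuous (fderiv ℝ φ) := hφ.continuous_fderiv (by simp)
  have hflux := fun μ => by
    have h := hw.integrable_flux K hK hKU μ
    rwa [IntegrableOn, restrict_prod_univ] at h
  have hone : ∀ q, |(1 : ℝ)| ≤ (m * c ^ 2)⁻¹ * energy m c q := fun q => by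
    have hmc : 0 < m * c ^ 2 := by positivity
    rw [abs_one, inv_mul_eq_div, one_le_div hmc]; exact le_energy hc q
  have hJ := hw.integrable_localJuttner hm hc hK hKU continuous_const hone
  have hfe : Integrable (fun z : Spacetime × E3 => 1 * f z.1 z.2 / energy m c z.2)
      ((volume.restrict K).prod volume) :=
    integrable_weight_of_le hm hc (hw.integrable hm hc hK hKU).aestronglyMeasurable
      continuous_const hone (by
        refine ((hflux 0).const_mul (m * c ^ 2)⁻¹).congr (Eventually.of_forall fun z => ?_)
        simp only [fourMomentum_zero]; ring)
  have hD : ∀ μ, Integrable (fun z : Spacetime × E3 => fderiv ℝ φ z (coordDir c μ, 0) *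
      (fourMomentum m c z.2 μ * f z.1 z.2 / energy m c z.2)) := fun μ => by
    have hcd : Continuous fun z => fderiv ℝ φ z (coordDir c μ, 0) :=
      hφf.clm_apply continuous_const
    obtain ⟨C, hC⟩ := hcd.bounded_above_of_compact_support (hcs.fderiv_apply ℝ _)
    exact integrable_mul_of_support hcd hC (fun z hz => by
      rw [fderiv_of_notMem_tsupport ℝ (hnot z hz)]; rfl) (hflux μ)
  have hR : Integrable (fun z : Spacetime × E3 => φ z *
      (1 * localJuttner m c (f z.1) z.2 / energy m c z.2 - 1 * f z.1 z.2 / energy m c z.2)) := by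
    obtain ⟨C, hC⟩ := hφ.continuous.bounded_above_of_compact_support hcs
    exact integrable_mul_of_support hφ.continuous hC
      (fun z hz => image_eq_zero_of_notMem_tsupport (hnot z hz)) (hJ.sub hfe)
  have hint : Integrable (fun z : Spacetime × E3 =>
      f z.1 z.2 * transport m c z.2 (fun X => φ (X, z.2)) z.1 +
      relaxation m c ω (f z.1) z.2 * φ z) := by
    refine (((integrable_finsetSum Finset.univ fun μ _ => hD μ).const_mul c).add
      (hR.const_mul (m * c ^ 2 * ω))).congr (Eventually.of_forall fun z => ?_)
    simp only [Pi.add_apply, transport_eq hm hc, partialST_section hφd, relaxation]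
    rw [Finset.mul_sum, Finset.mul_sum]
    congr 1
    · exact Finset.sum_congr rfl fun μ _ => by ring
    · ring
  rw [Measure.volume_eq_prod] at hint ⊢
  -- With the space-time integral inside, `q` is fixed and integration by parts uses only the `C¹`
  -- regularity of `f(·, ·, q)`.
  rw [integral_prod_symm _ hint]
  refine integral_eq_zero_of_ae (Eventually.of_forall fun q => ?_)
  have hts := tsupport_section_subset φ q
  have hψ1 : ContDiff ℝ 1 fun X => φ (X, q) :=
    (hφ.comp (contDiff_id.prodMk contDiff_const)).of_le (by exact_mod_cast le_top)
  have hψcs : HasCompactSupport fun X => φ (X, q) :=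
    hK.of_isClosed_subset (isClosed_tsupport _) fun X hX => ⟨(X, q), hts hX, rfl⟩
  have hψU : tsupport (fun X => φ (X, q)) ⊆ U := fun X hX => (hU (hts hX)).1
  have := (integral_mul_fderiv_add hUo (hf.contDiff q) hψ1 hψcs hψU
    (∑ μ, (c * (fourMomentum m c q μ / energy m c q)) • coordDir c μ)).2
  simp only [Pi.zero_apply]
  rw [← this]
  congr 1; ext X
  rw [← transport_eq_fderiv hm hc, ← transport_eq_fderiv hm hc]
  by_cases hX : X ∈ U
  · rw [hf.equation X hX q]
  · have h0 : φ (X, q) = 0 :=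
      image_eq_zero_of_notMem_tsupport (f := fun X => φ (X, q)) fun h => hX (hψU h)
    rw [h0, mul_zero, mul_zero]

end

end RelBGK

theorem mainTheorem2 (m c : ℝ) (hm : 0 < m) (hc : 0 < c) :
    -- existence, uniqueness and identification of the parameters
    (∀ f : E3 → ℝ, (∀ᵐ q, 0 ≤ f q) → ¬ (∀ᵐ q, f q = 0) → HasMoments m c f →
      (∃! p : ℝ × ℝ × E3, 0 ≤ p.1 ∧ 0 < p.2.1 ∧
        SameMoments m c f (juttner m c p.1 p.2.1 p.2.2)) ∧
      0 < properDensity m c f ∧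
      (∃! β : ℝ, SolvesBetaEq m c f β) ∧
      SolvesBetaEq m c f (beta m c f) ∧
      SameMoments m c f
        (juttner m c (properDensity m c f) (beta m c f) (velocity m c f))) ∧
    -- conservation laws for the relativistic BGK equation, over any open region of space-time
    (∀ (ω : ℝ) (U : Set Spacetime) (f : Spacetime → E3 → ℝ), IsOpen U →
      -- distributional solutions
      (IsWeakPhaseDensity m c U f → IsWeakSolution m c ω U f →
        WeakDivFree c U (fun X => particleFlux m c (f X)) ∧
        ∀ μ, WeakDivFree c U (fun X => energyMomentum m c (f X) μ)) ∧
      -- classical solutions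
      (IsClassicalSolution m c ω U f →
        DivFree c U (fun X => particleFlux m c (f X)) ∧
        ∀ μ, DivFree c U (fun X => energyMomentum m c (f X) μ))) := by
  refine ⟨fun f h0 h1 hf => ⟨existsUnique_juttner hm hc h0 h1 hf,
    (properDensity_sq hm hc h0 h1 hf).2, existsUnique_solvesBetaEq hm hc h0 h1 hf,
    solvesBetaEq_beta hm hc h0 h1 hf, sameMoments_localJuttner_of_ne_zero hm hc h0 h1 hf⟩,
    fun ω U f hUo => ⟨fun hw hsol => ⟨hw.weakDivFree_particleFlux hm hc hUo hsol,
      hw.weakDivFree_energyMomentum hm hc hUo hsol⟩, fun hf => ?_⟩⟩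
  have hw := hf.isWeakPhaseDensity hm hc hUo
  have hsol := hf.isWeakSolution hm hc hUo
  exact ⟨(hw.weakDivFree_particleFlux hm hc hUo hsol).divFree hUo hf.contDiff_flux, fun μ =>
    (hw.weakDivFree_energyMomentum hm hc hUo hsol μ).divFree hUo (hf.contDiff_tensor μ)⟩
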